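/- Let $d\ge 2$, let $S=\mathbb S^{d-1}\subset\mathbb R^d$ be the unit sphere, and for $\rho>0$ let $\mathrm d\omega_{\rho S}$ be the Euclidean surface measure on $\rho S$. With $\widehat\varphi(\xi)=\int_{\mathbb R^d}e^{-2\pi i x\cdot\xi}\varphi(x)\,\mathrm dx$, let $\mathcal F_{\rho S}:\mathcal S(\mathbb R^d)\to L^2(\rho S,\mathrm d\omega_{\rho S})$, $\varphi\mapsto\widehat\varphi|_{\rho S}$, be the Fourier restriction operator, and let $$(\mathcal F_{\rho S}^*u)(x)=\int_{\rho S}u(\xi)\,e^{2\pi i x\cdot\xi}\,\mathrm d\omega_{\rho S}(\xi),\qquad u\in L^2(\rho S),$$ be its adjoint, the Fourier extension operator. For $0<t<1$ put $S_t^{\pm}=\sqrt{1\pm t}\,S$. **Proposition.** Let $0<\tau<1$, $1\le p<\frac{2(d+1)}{d+3}$, $\frac1p+\frac1{p'}=1$, $\frac1q=\frac1p-\frac1{p'}$ (so that $1\le q<\frac{d+1}2$), and $0<\alpha<\min\{\frac{d+1}2-q,\,q\}$. Then there is a constant $C$, depending only on $d,\alpha,q,\tau$, such that for every $t\in(0,\tau)$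 and for each choice of the sign $\pm$ the operator $$\mathcal F_{S_t^\pm}^*\mathcal F_{S_t^\pm}-\sqrt{1\pm t}\,\mathcal F_S^*\mathcal F_S,$$ defined on $\mathcal S(\mathbb R^d)$, extends to a bounded operator $L^p(\mathbb R^d)\to L^{p'}(\mathbb R^d)$ with $$\bigl\|\mathcal F_{S_t^\pm}^*\mathcal F_{S_t^\pm}-\sqrt{1\pm t}\,\mathcal F_S^*\mathcal F_S\bigr\|_{L^p\to L^{p'}}\le C\,t^{\alpha/q}.$$ -/

import Mathlib

open MeasureTheory Set
open scoped ENNReal SchwartzMap FourierTransform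

/-- Euclidean surface measure on the sphere `ρ S = {ξ : ‖ξ‖ = ρ}` (`S` the unit sphere of `ℝᵈ`),
regarded as a measure on `ℝᵈ` carried by that sphere: the image of the surface measure of `S`
under `ω ↦ ρ ω`, multiplied by the Jacobian `ρ ^ (d - 1)`. It is meant for `ρ > 0`, `d ≥ 1`. -/
noncomputable def sphereMeasure (d : ℕ) (ρ : ℝ) : Measure (EuclideanSpace ℝ (Fin d)) :=
  ENNReal.ofReal (ρ ^ (d - 1)) •
    (volume : Measure (EuclideanSpace ℝ (Fin d))).toSphere.map (fun ω => ρ • ω.1)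

instance sphereMeasure.instIsFiniteMeasure (d : ℕ) (ρ : ℝ) :
    IsFiniteMeasure (sphereMeasure d ρ) := by
  unfold sphereMeasure
  exact Measure.smul_finite _ ENNReal.ofReal_ne_top

/-- The Fourier restriction operator `𝓢(ℝᵈ) → L²(ρ S)`, `φ ↦ φ̂|_{ρ S}`, where
`φ̂ ξ = ∫ exp (-2 π i x · ξ) φ x dx`. -/
noncomputable def fourierRestriction (d : ℕ) (ρ : ℝ) :
    𝓢(EuclideanSpace ℝ (Fin d), ℂ) →L[ℂ] Lp ℂ 2 (sphereMeasure d ρ) :=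
  (SchwartzMap.toLpCLM ℂ ℂ 2 (sphereMeasure d ρ)).comp
    (FourierTransform.fourierCLM ℂ 𝓢(EuclideanSpace ℝ (Fin d), ℂ))

/-- The Fourier extension operator, the adjoint of `fourierRestriction d ρ`:
`u ↦ (x ↦ ∫_{ρ S} exp (2 π i x · ξ) u ξ dω(ξ))` for `u ∈ L²(ρ S)`. -/
noncomputable def fourierExtension (d : ℕ) (ρ : ℝ) (u : Lp ℂ 2 (sphereMeasure d ρ))
    (x : EuclideanSpace ℝ (Fin d)) : ℂ :=
  ∫ ξ, Complex.exp (2 * Real.pi * Complex.I * (inner ℝ x ξ : ℝ)) * u ξ ∂(sphereMeasure d ρ)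

/-- `A : L^p(ℝᵈ) → L^{p'}(ℝᵈ)` is a bounded extension of the operator `T`, given on Schwartz
functions. For `p < ∞` there is at most one such `A`, as Schwartz functions are dense in `L^p`,
and then `‖A‖` is the `L^p → L^{p'}` norm of `T`. -/
def ExtendsOnSchwartz {d : ℕ} {p p' : ℝ≥0∞} [Fact (1 ≤ p)] [Fact (1 ≤ p')]
    (T : 𝓢(EuclideanSpace ℝ (Fin d), ℂ) → EuclideanSpace ℝ (Fin d) → ℂ)
    (A : Lp ℂ p (volume : Measure (EuclideanSpace ℝ (Fin d))) →L[ℂ]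
      Lp ℂ p' (volume : Measure (EuclideanSpace ℝ (Fin d)))) : Prop :=
  ∀ φ : 𝓢(EuclideanSpace ℝ (Fin d), ℂ), A (φ.toLp p volume) =ᵐ[volume] T φ

/-- The composition `𝓕_{ρS}^* 𝓕_{ρS}` of restriction and extension, on Schwartz functions. -/
noncomputable def fourierExtRestr (d : ℕ) (ρ : ℝ) (φ : 𝓢(EuclideanSpace ℝ (Fin d), ℂ)) :
    EuclideanSpace ℝ (Fin d) → ℂ :=
  fourierExtension d ρ (fourierRestriction d ρ φ)

/-!
The operator in question is the convolution with the radial kernel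
`K x = r ^ (d - 1) g (r |x|) - r g |x|`, where `r = √(1 ± t)` and `g = sphereProfile d` is the
Fourier transform of the surface measure of the unit sphere. The proof is the dyadic argument of
Tomas for the restriction theorem, with a gain of `(t lam) ^ a`, `a = α / q`, at each scale `lam`.

*Decay.* `g` solves a Bessel equation (`sphereProfile_ode`), which only expresses the rotation
invariance of the surface measure. An energy estimate for that equation gives
`|g R|, |g' R| ≤ C (1 + R) ^ (-(d - 1) / 2)` (`exists_sphereProfile_decay`). As `|r - 1| ≤ t`, it
follows that `|K x| ≤ C (t (1 + |x|)) ^ a (1 + |x|) ^ (-(d - 1) / 2)` (`exists_diffKernel_le`).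

*Frequency side.* The Fourier transform of `K` cut off at `|x| ~ lam` is a difference of surface
measures smoothed at scale `lam⁻¹`, hence at most `C (t lam) ^ a lam`
(`exists_diffMultiplier_le`); the point is that a ball of radius `lam⁻¹` carries mass
`O(lam ^ (1 - d))` of each sphere (`exists_integral_decayWeight_sphere_le`).

*Interpolation.* The first bound controls the bilinear form of the piece on `L¹ × L¹`, the second,
through Plancherel's theorem, on `L² × L²` (`norm_convForm_le_of_multiplier`). By the three lines
theorem (`norm_convForm_le_interp`) the form on `Lᵖ × Lᵖ` is bounded by
`C t ^ a lam ^ (a + 1 - (d + 1) / (2 q))`, where `1 / q = 2 / p - 1`. The exponent of `lam` is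
negative exactly because `α < (d + 1) / 2 - q`, so the sum over `lam = 2 ^ j` converges
(`exists_norm_convForm_diffKernel_le`). Duality and the density of Schwartz functions turn the
bound of the form into one of the operator; for `p = 1` the kernel bound suffices.
-/

/-! ### The surface measure of the unit sphere -/

section Sphere

open scoped Pointwise

/-- The surface measure of the unit sphere, as a measure on the ambient space. -/
noncomputable def unitSphereMeasure (d : ℕ) : Measure (EuclideanSpace ℝ (Fin d)) :=
  (volume : Measure (EuclideanSpace ℝ (Fin d))).toSphere.map Subtype.val

instance unitSphereMeasure.instIsFiniteMeasure (d : ℕ) : IsFiniteMeasure (unitSphereMeasure d) := by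
  unfold unitSphereMeasure
  infer_instance

theorem ae_norm_eq_one_unitSphereMeasure (d : ℕ) : ∀ᵐ ω ∂unitSphereMeasure d, ‖ω‖ = 1 := by
  unfold unitSphereMeasure
  rw [ae_map_iff (by fun_prop) (measurableSet_eq_fun (by fun_prop) (by fun_prop))]
  exact Filter.Eventually.of_forall fun ω => by simp

theorem sphereMeasure_eq_smul_map (d : ℕ) (ρ : ℝ) :
    sphereMeasure d ρ =
      ENNReal.ofReal (ρ ^ (d - 1)) • (unitSphereMeasure d).map (fun ω => ρ • ω) := by
  unfold sphereMeasure unitSphereMeasure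
  rw [Measure.map_map (by fun_prop) (by fun_prop)]
  rfl

theorem integral_sphereMeasure {d : ℕ} {ρ : ℝ} (hρ : 0 ≤ ρ) {F : Type*} [NormedAddCommGroup F]
    [NormedSpace ℝ F] [SecondCountableTopology F] [MeasurableSpace F] [BorelSpace F]
    {f : EuclideanSpace ℝ (Fin d) → F} (hf : Continuous f) :
    ∫ x, f x ∂sphereMeasure d ρ = ρ ^ (d - 1) • ∫ ω, f (ρ • ω) ∂unitSphereMeasure d := by
  rw [sphereMeasure_eq_smul_map, integral_smul_measure,
    integral_map (by fun_prop) hf.aestronglyMeasurable, ENNReal.toReal_ofReal (by positivity)]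

theorem map_linearIsometryEquiv_unitSphereMeasure {d : ℕ}
    (U : EuclideanSpace ℝ (Fin d) ≃ₗᵢ[ℝ] EuclideanSpace ℝ (Fin d)) :
    (unitSphereMeasure d).map U = unitSphereMeasure d := by
  have key : ∀ s : Set (EuclideanSpace ℝ (Fin d)), MeasurableSet s → unitSphereMeasure d s =
      Module.finrank ℝ (EuclideanSpace ℝ (Fin d)) *
        volume (Ioo (0 : ℝ) 1 • (s ∩ Metric.sphere 0 1)) := by
    intro s hs
    unfold unitSphereMeasure
    rw [Measure.map_apply (by fun_prop) hs, Measure.toSphere_apply' _ (hs.preimage (by fun_prop)),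
      Subtype.image_preimage_coe, inter_comm]
  ext s hs
  have hU : MeasurableSet (U ⁻¹' s) := hs.preimage U.continuous.measurable
  rw [Measure.map_apply U.continuous.measurable hs, key _ hU, key _ hs]
  have h : Ioo (0 : ℝ) 1 • (U ⁻¹' s ∩ Metric.sphere 0 1)
      = U ⁻¹' (Ioo (0 : ℝ) 1 • (s ∩ Metric.sphere 0 1)) := by
    ext x
    simp only [Set.mem_smul, mem_inter_iff, mem_preimage, mem_sphere_iff_norm, sub_zero]
    constructor
    · rintro ⟨c, hc, y, ⟨hy, hy1⟩, rfl⟩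
      exact ⟨c, hc, U y, ⟨hy, by simpa using hy1⟩, by simp⟩
    · rintro ⟨c, hc, y, ⟨hy, hy1⟩, hx⟩
      refine ⟨c, hc, U.symm y, ⟨by simpa using hy, by simpa using hy1⟩, ?_⟩
      rw [← map_smul, hx, U.symm_apply_apply]
  rw [h]
  congr 1
  exact U.measurePreserving.measure_preimage_emb U.toMeasurableEquiv.measurableEmbedding _

theorem integral_unitSphereMeasure_comp {d : ℕ}
    (U : EuclideanSpace ℝ (Fin d) ≃ₗᵢ[ℝ] EuclideanSpace ℝ (Fin d))
    (f : EuclideanSpace ℝ (Fin d) → ℝ) :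
    ∫ ω, f (U ω) ∂unitSphereMeasure d = ∫ ω, f ω ∂unitSphereMeasure d := by
  conv_rhs => rw [← map_linearIsometryEquiv_unitSphereMeasure U]
  exact (U.toMeasurableEquiv.measurableEmbedding.integral_map f).symm

/-- Polar coordinates. Only this inequality is needed, and it holds for all `d`. -/
theorem lintegral_unitSphereMeasure_lintegral_Ioi_le {d : ℕ}
    {f : EuclideanSpace ℝ (Fin d) → ℝ≥0∞} (hf : Measurable f) :
    ∫⁻ ω, (∫⁻ s in Ioi (0 : ℝ), ENNReal.ofReal (s ^ (d - 1)) * f (s • ω)) ∂unitSphereMeasure d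
      ≤ ∫⁻ x, f x := by
  have h1 := (Measure.measurePreserving_homeomorphUnitSphereProd
    (volume : Measure (EuclideanSpace ℝ (Fin d)))).lintegral_comp_emb
      (Homeomorph.measurableEmbedding _) (fun p => f (p.2.1 • p.1.1))
  have h2 : ∀ x : ({0}ᶜ : Set (EuclideanSpace ℝ (Fin d))),
      ((homeomorphUnitSphereProd (EuclideanSpace ℝ (Fin d)) x).2 : ℝ) •
        ((homeomorphUnitSphereProd (EuclideanSpace ℝ (Fin d)) x).1 : EuclideanSpace ℝ (Fin d))
        = x := by
    rintro ⟨x, hx⟩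
    have : ‖x‖ ≠ 0 := by simpa using hx
    simp [smul_smul, this]
  have h3 : ∫⁻ x : ({0}ᶜ : Set (EuclideanSpace ℝ (Fin d))), f x
      ∂(Measure.comap Subtype.val volume) ≤ ∫⁻ x, f x := by
    rw [lintegral_subtype_comap (measurableSet_singleton _).compl]
    exact setLIntegral_le_lintegral _ _
  simp only [h2] at h1
  rw [h1, lintegral_prod _ (by fun_prop)] at h3
  refine le_trans (le_of_eq ?_) h3
  unfold unitSphereMeasure
  have hm : Measurable fun ω : EuclideanSpace ℝ (Fin d) =>
      ∫⁻ s in Ioi (0 : ℝ), ENNReal.ofReal (s ^ (d - 1)) * f (s • ω) := by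
    apply Measurable.lintegral_prod_right'
      (f := fun p : EuclideanSpace ℝ (Fin d) × ℝ => ENNReal.ofReal (p.2 ^ (d - 1)) * f (p.2 • p.1))
    fun_prop
  rw [lintegral_map hm (by fun_prop)]
  refine lintegral_congr fun ω => ?_
  rw [Measure.volumeIoiPow, lintegral_withDensity_eq_lintegral_mul _ (by fun_prop) (by fun_prop)]
  simp only [Pi.mul_apply, finrank_euclideanSpace, Fintype.card_fin]
  rw [← lintegral_subtype_comap measurableSet_Ioi]

/-- The integrable weight `(1 + ‖x‖) ^ (-(d + 1))` on `ℝᵈ`. -/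
noncomputable def decayWeight (d : ℕ) (x : EuclideanSpace ℝ (Fin d)) : ℝ :=
  (1 + ‖x‖) ^ (-((d : ℝ) + 1))

theorem decayWeight_pos (d : ℕ) (x : EuclideanSpace ℝ (Fin d)) : 0 < decayWeight d x := by
  unfold decayWeight; positivity

@[fun_prop]
theorem continuous_decayWeight (d : ℕ) : Continuous (decayWeight d) := by
  unfold decayWeight
  refine Continuous.rpow_const (by fun_prop) fun x => Or.inl ?_
  positivity

theorem integrable_decayWeight (d : ℕ) : Integrable (decayWeight d) :=
  integrable_one_add_norm (by simp)

theorem decayWeight_le {d : ℕ} {x y : EuclideanSpace ℝ (Fin d)} (h : ‖x - y‖ ≤ 1) :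
    decayWeight d x ≤ 2 ^ (d + 1) * decayWeight d y := by
  unfold decayWeight
  have h1 : ‖y‖ ≤ ‖x‖ + ‖x - y‖ := by
    have := norm_sub_le x (x - y)
    simpa using this
  have h2 : (1 + ‖y‖) / 2 ≤ 1 + ‖x‖ := by linarith [norm_nonneg x]
  calc (1 + ‖x‖) ^ (-((d : ℝ) + 1)) ≤ ((1 + ‖y‖) / 2) ^ (-((d : ℝ) + 1)) :=
        Real.rpow_le_rpow_of_nonpos (by positivity) h2 (by linarith [d.cast_nonneg (α := ℝ)])
    _ = 2 ^ (d + 1) * (1 + ‖y‖) ^ (-((d : ℝ) + 1)) := by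
        rw [Real.div_rpow (by positivity) (by norm_num), Real.rpow_neg (by norm_num : (0 : ℝ) ≤ 2),
          div_inv_eq_mul, mul_comm]
        norm_cast

/-- The rescaled weight `lam ^ d * decayWeight d (lam • x)`, of mass `O(1)` on a ball of radius
`lam⁻¹`, has mass `O(lam)` on every sphere: a point of the sphere can be compared with the points
at distance at most `lam⁻¹` on the same ray, which fill a shell of the ambient space. -/
theorem exists_integral_decayWeight_sphere_le (d : ℕ) {r₀ : ℝ} (hr₀ : 0 < r₀) :
    ∃ C, 0 ≤ C ∧ ∀ r, r₀ ≤ r → ∀ lam, 1 ≤ lam → ∀ ξ : EuclideanSpace ℝ (Fin d),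
      lam ^ d * ∫ ω, decayWeight d (lam • (ξ - r • ω)) ∂unitSphereMeasure d ≤ C * lam := by
  set I : ℝ := ∫ x, decayWeight d x with hI
  have hI0 : 0 ≤ I := integral_nonneg fun x => (decayWeight_pos d x).le
  refine ⟨2 ^ (d + 1) * (r₀ ^ (d - 1))⁻¹ * I, by positivity, ?_⟩
  intro r hr lam hlam ξ
  have hlam0 : 0 < lam := by linarith
  have hr' : 0 < r := by linarith
  set f : EuclideanSpace ℝ (Fin d) → ℝ≥0∞ :=
    fun x => ENNReal.ofReal (decayWeight d (lam • (ξ - x))) with hf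
  have hfm : Measurable f :=
    Measurable.ennreal_ofReal (Continuous.measurable (by fun_prop))
  have hint : ∫⁻ x, f x = ENNReal.ofReal ((lam ^ d)⁻¹ * I) := by
    rw [← ofReal_integral_eq_lintegral_ofReal]
    · congr 1
      rw [integral_sub_left_eq_self (fun x => decayWeight d (lam • x)),
        Measure.integral_comp_smul]
      simp [abs_of_pos hlam0, hI]
    · exact ((integrable_decayWeight d).comp_smul hlam0.ne').comp_sub_left ξ
    · exact Filter.Eventually.of_forall fun x => (decayWeight_pos d _).le
  -- keep only the part `r < s ≤ r + lam⁻¹` of the ray through `ω`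
  have hpt : ∀ᵐ ω ∂unitSphereMeasure d,
      ENNReal.ofReal (r₀ ^ (d - 1) * (2 ^ (d + 1))⁻¹ * lam⁻¹) * f (r • ω) ≤
        ∫⁻ s in Ioi (0 : ℝ), ENNReal.ofReal (s ^ (d - 1)) * f (s • ω) := by
    filter_upwards [ae_norm_eq_one_unitSphereMeasure d] with ω hω
    calc ENNReal.ofReal (r₀ ^ (d - 1) * (2 ^ (d + 1))⁻¹ * lam⁻¹) * f (r • ω)
        = ∫⁻ s in Ioc r (r + lam⁻¹), ENNReal.ofReal (r₀ ^ (d - 1) * (2 ^ (d + 1))⁻¹)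
            * f (r • ω) := by
          rw [setLIntegral_const, Real.volume_Ioc, add_sub_cancel_left,
            ENNReal.ofReal_mul (p := r₀ ^ (d - 1) * (2 ^ (d + 1))⁻¹) (by positivity)]
          ring
      _ ≤ ∫⁻ s in Ioc r (r + lam⁻¹), ENNReal.ofReal (s ^ (d - 1)) * f (s • ω) := by
          refine setLIntegral_mono' measurableSet_Ioc fun s hs => ?_
          rw [ENNReal.ofReal_mul (by positivity), mul_assoc]
          gcongr
          · exact hr.trans hs.1.le
          · rw [hf]
            simp only
            rw [← ENNReal.ofReal_mul (by positivity)]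
            apply ENNReal.ofReal_le_ofReal
            rw [inv_mul_le_iff₀ (by positivity)]
            apply decayWeight_le
            rw [← smul_sub, sub_sub_sub_cancel_left, ← sub_smul, norm_smul, norm_smul, hω, mul_one,
              Real.norm_of_nonneg hlam0.le, Real.norm_of_nonneg (by linarith [hs.1])]
            calc lam * (s - r) ≤ lam * lam⁻¹ := by gcongr; linarith [hs.2]
              _ = 1 := mul_inv_cancel₀ hlam0.ne'
      _ ≤ _ := lintegral_mono_set fun s hs => hr'.trans hs.1
  have hmain := (lintegral_mono_ae hpt).trans (lintegral_unitSphereMeasure_lintegral_Ioi_le hfm)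
  rw [lintegral_const_mul _ (by fun_prop), hint] at hmain
  have hcont : Continuous fun ω : EuclideanSpace ℝ (Fin d) =>
    decayWeight d (lam • (ξ - r • ω)) := by fun_prop
  have heq : ∫ ω, decayWeight d (lam • (ξ - r • ω)) ∂unitSphereMeasure d
      = (∫⁻ ω, f (r • ω) ∂unitSphereMeasure d).toReal :=
    integral_eq_lintegral_of_nonneg_ae
      (Filter.Eventually.of_forall fun x => (decayWeight_pos d _).le) hcont.aestronglyMeasurable
  rw [heq]
  have hR := ENNReal.toReal_mono ENNReal.ofReal_ne_top hmain
  rw [ENNReal.toReal_mul, ENNReal.toReal_ofReal (by positivity),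
    ENNReal.toReal_ofReal (by positivity)] at hR
  set X := (∫⁻ ω, f (r • ω) ∂unitSphereMeasure d).toReal
  have hl : 0 < lam ^ d := by positivity
  have hr0 : 0 < r₀ ^ (d - 1) := by positivity
  calc lam ^ d * X = lam ^ d * (2 ^ (d + 1) * (r₀ ^ (d - 1))⁻¹ * lam) *
        (r₀ ^ (d - 1) * (2 ^ (d + 1))⁻¹ * lam⁻¹ * X) := by field_simp
    _ ≤ lam ^ d * (2 ^ (d + 1) * (r₀ ^ (d - 1))⁻¹ * lam) * ((lam ^ d)⁻¹ * I) := by gcongr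
    _ = 2 ^ (d + 1) * (r₀ ^ (d - 1))⁻¹ * I * lam := by field_simp

end Sphere

/-! ### Decay of the Fourier transform of the surface measure -/

section Decay

variable {d : ℕ}

theorem integrable_unitSphereMeasure_of_continuous {F : Type*} [NormedAddCommGroup F]
    [SecondCountableTopology F] [MeasurableSpace F] [BorelSpace F]
    {f : EuclideanSpace ℝ (Fin d) → F} (hf : Continuous f) :
    Integrable f (unitSphereMeasure d) := by
  obtain ⟨C, hC⟩ := (isCompact_sphere (0 : EuclideanSpace ℝ (Fin d)) 1).exists_bound_of_continuousOn
    hf.continuousOn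
  refine Integrable.of_bound hf.aestronglyMeasurable C ?_
  filter_upwards [ae_norm_eq_one_unitSphereMeasure d] with ω hω
  exact hC ω (by simpa using hω)

theorem hasDerivAt_integral_cos {A a b : EuclideanSpace ℝ (Fin d) → ℝ} (hA : Continuous A)
    (ha : Continuous a) (hb : Continuous b) (s : ℝ) :
    HasDerivAt (fun s => ∫ ω, A ω * Real.cos (a ω + s * b ω) ∂unitSphereMeasure d)
      (∫ ω, -(A ω * b ω * Real.sin (a ω + s * b ω)) ∂unitSphereMeasure d) s := by
  refine (hasDerivAt_integral_of_dominated_loc_of_deriv_le (μ := unitSphereMeasure d)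
    (F := fun s ω => A ω * Real.cos (a ω + s * b ω))
    (F' := fun s ω => -(A ω * b ω * Real.sin (a ω + s * b ω)))
    (bound := fun ω => |A ω * b ω|) (s := univ) Filter.univ_mem
    (Filter.Eventually.of_forall fun x => Continuous.aestronglyMeasurable (by fun_prop))
    (integrable_unitSphereMeasure_of_continuous (by fun_prop))
    (Continuous.aestronglyMeasurable (by fun_prop)) ?_
    (integrable_unitSphereMeasure_of_continuous (by fun_prop)) ?_).2
  · refine Filter.Eventually.of_forall fun ω x _ => ?_
    rw [norm_neg, Real.norm_eq_abs, abs_mul (A ω * b ω)]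
    exact mul_le_of_le_one_right (abs_nonneg _) (Real.abs_sin_le_one _)
  · refine Filter.Eventually.of_forall fun ω x _ => ?_
    have h : HasDerivAt (fun x : ℝ => a ω + x * b ω) (b ω) x := by
      simpa using ((hasDerivAt_id x).mul_const (b ω)).const_add (a ω)
    exact (h.cos.const_mul (A ω)).congr_deriv (by ring)

theorem hasDerivAt_integral_sin {A a b : EuclideanSpace ℝ (Fin d) → ℝ} (hA : Continuous A)
    (ha : Continuous a) (hb : Continuous b) (s : ℝ) :
    HasDerivAt (fun s => ∫ ω, A ω * Real.sin (a ω + s * b ω) ∂unitSphereMeasure d)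
      (∫ ω, A ω * b ω * Real.cos (a ω + s * b ω) ∂unitSphereMeasure d) s := by
  have h := hasDerivAt_integral_cos hA (a := fun ω => a ω - Real.pi / 2) (by fun_prop) hb s
  have e : ∀ x y : ℝ, x - Real.pi / 2 + y = x + y - Real.pi / 2 := fun x y => by ring
  simp only [e, Real.cos_sub_pi_div_two, Real.sin_sub_pi_div_two, mul_neg, neg_neg] at h
  exact h

/-- The radial profile of the Fourier transform of the surface measure of the unit sphere:
`∫ cos (2 π R ω₀) dω`, up to normalization the Bessel function `R ^ (1 - d / 2) J_{d/2-1} (2 π R)`.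
The first coordinate stands for an arbitrary direction. -/
noncomputable def sphereProfile (d : ℕ) [NeZero d] (R : ℝ) : ℝ :=
  ∫ ω, Real.cos (2 * Real.pi * (R * ω 0)) ∂unitSphereMeasure d

/-- The derivative of `sphereProfile`. -/
noncomputable def sphereProfileDeriv (d : ℕ) [NeZero d] (R : ℝ) : ℝ :=
  -∫ ω, 2 * Real.pi * ω 0 * Real.sin (2 * Real.pi * (R * ω 0)) ∂unitSphereMeasure d

variable [NeZero d]

theorem hasDerivAt_sphereProfile (R : ℝ) :
    HasDerivAt (sphereProfile d) (sphereProfileDeriv d R) R := by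
  have h := hasDerivAt_integral_cos (d := d) (A := fun _ => 1) (a := fun _ => 0)
    (b := fun ω => 2 * Real.pi * ω 0) (by fun_prop) (by fun_prop) (by fun_prop) R
  have e : ∀ x y : ℝ, x * (2 * Real.pi * y) = 2 * Real.pi * (x * y) := fun x y => by ring
  simp only [one_mul, zero_add, e, integral_neg] at h
  exact h

theorem hasDerivAt_sphereProfileDeriv (R : ℝ) :
    HasDerivAt (sphereProfileDeriv d)
      (-∫ ω, (2 * Real.pi) ^ 2 * (ω 0) ^ 2 * Real.cos (2 * Real.pi * (R * ω 0))
        ∂unitSphereMeasure d) R := by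
  have h := (hasDerivAt_integral_sin (d := d) (A := fun ω => 2 * Real.pi * ω 0) (a := fun _ => 0)
    (b := fun ω => 2 * Real.pi * ω 0) (by fun_prop) (by fun_prop) (by fun_prop) R).neg
  have e : ∀ x y : ℝ, x * (2 * Real.pi * y) = 2 * Real.pi * (x * y) := fun x y => by ring
  have e2 : ∀ y : ℝ, 2 * Real.pi * (2 * Real.pi * y * y) = (2 * Real.pi) ^ 2 * y ^ 2 :=
    fun y => by ring
  simp only [zero_add, e, e2] at h
  exact h

theorem integral_cos_inner_eq_sphereProfile (x : EuclideanSpace ℝ (Fin d)) :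
    ∫ ω, Real.cos (2 * Real.pi * inner ℝ x ω) ∂unitSphereMeasure d = sphereProfile d ‖x‖ := by
  set v : EuclideanSpace ℝ (Fin d) := EuclideanSpace.single 0 ‖x‖ with hv
  have hn : ‖x‖ = ‖v‖ := by simp [hv]
  set U := (Submodule.span ℝ {x - v})ᗮ.reflection with hU
  have hUx : U x = v := Submodule.reflection_sub hn
  rw [← integral_unitSphereMeasure_comp U]
  unfold sphereProfile
  refine integral_congr_ae (Filter.Eventually.of_forall fun ω => ?_)
  have h1 : inner ℝ x (U ω) = inner ℝ v ω := by
    rw [← hUx, ← LinearIsometryEquiv.inner_map_map U x (U ω), hU, Submodule.reflection_reflection]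
  simp only [h1, hv, EuclideanSpace.inner_single_left]
  simp

/-- The oscillatory integral is real because the surface measure is symmetric. -/
theorem integral_exp_inner_eq_sphereProfile (x : EuclideanSpace ℝ (Fin d)) :
    ∫ ω, Complex.exp (2 * Real.pi * Complex.I * (inner ℝ x ω : ℝ)) ∂unitSphereMeasure d
      = sphereProfile d ‖x‖ := by
  have hsin : ∫ ω, Real.sin (2 * Real.pi * inner ℝ x ω) ∂unitSphereMeasure d = 0 := by
    have h := integral_unitSphereMeasure_comp (LinearIsometryEquiv.neg ℝ)
      (fun ω : EuclideanSpace ℝ (Fin d) => Real.sin (2 * Real.pi * inner ℝ x ω))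
    simp only [LinearIsometryEquiv.coe_neg, inner_neg_right, mul_neg, Real.sin_neg,
      integral_neg] at h
    linarith
  have h : ∀ ω : EuclideanSpace ℝ (Fin d),
      Complex.exp (2 * Real.pi * Complex.I * (inner ℝ x ω : ℝ)) =
        (Real.cos (2 * Real.pi * inner ℝ x ω) : ℂ) +
          (Real.sin (2 * Real.pi * inner ℝ x ω) : ℂ) * Complex.I := by
    intro ω
    rw [Complex.ofReal_cos, Complex.ofReal_sin, ← Complex.exp_mul_I]
    congr 1
    push_cast
    ring
  simp only [h]
  rw [integral_add (integrable_unitSphereMeasure_of_continuous (by fun_prop))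
    (integrable_unitSphereMeasure_of_continuous (by fun_prop)), integral_mul_const,
    integral_complex_ofReal, integral_complex_ofReal, hsin, integral_cos_inner_eq_sphereProfile]
  simp

/-- Differentiating `x ↦ sphereProfile d ‖x‖` twice at `R e₀` in a direction orthogonal to `e₀`. -/
theorem integral_sq_coord_mul_cos {k : Fin d} (hk : k ≠ 0) {R : ℝ} (hR : 0 < R) :
    ∫ ω, (2 * Real.pi) ^ 2 * (ω k) ^ 2 * Real.cos (2 * Real.pi * (R * ω 0)) ∂unitSphereMeasure d
      = -(sphereProfileDeriv d R / R) := by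
  set ρ : ℝ → ℝ := fun s => Real.sqrt (R ^ 2 + s ^ 2) with hρ
  have hpos : ∀ s, 0 < R ^ 2 + s ^ 2 := fun s => by positivity
  have hρ0 : ρ 0 = R := by simp [hρ, hR.le]
  have hnorm : ∀ s, ‖(EuclideanSpace.single 0 R + EuclideanSpace.single k s :
      EuclideanSpace ℝ (Fin d))‖ = ρ s := by
    intro s
    rw [hρ]
    simp only
    rw [eq_comm, Real.sqrt_eq_iff_mul_self_eq (hpos s).le (norm_nonneg _), ← sq, norm_add_sq_real]
    simp [EuclideanSpace.inner_single_left, hk]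
  have hρd : ∀ s, HasDerivAt ρ (s / ρ s) s := by
    intro s
    have h := (((hasDerivAt_id s).pow 2).const_add (R ^ 2)).sqrt (hpos s).ne'
    refine h.congr_deriv ?_
    simp [hρ]
    ring
  have hG : ∀ s, ∫ ω, 1 * Real.cos (2 * Real.pi * (R * ω 0) + s * (2 * Real.pi * ω k))
      ∂unitSphereMeasure d = sphereProfile d (ρ s) := by
    intro s
    rw [← hnorm s, ← integral_cos_inner_eq_sphereProfile]
    refine integral_congr_ae (Filter.Eventually.of_forall fun ω => ?_)
    simp [inner_add_left, EuclideanSpace.inner_single_left]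
    ring_nf
  -- the first derivative in the direction `e_k`, computed in two ways
  have h1 : ∀ s, ∫ ω, -(2 * Real.pi * ω k *
      Real.sin (2 * Real.pi * (R * ω 0) + s * (2 * Real.pi * ω k))) ∂unitSphereMeasure d
        = sphereProfileDeriv d (ρ s) * (s / ρ s) := by
    intro s
    have ha := hasDerivAt_integral_cos (d := d) (A := fun _ => 1)
      (a := fun ω => 2 * Real.pi * (R * ω 0)) (b := fun ω => 2 * Real.pi * ω k)
      (by fun_prop) (by fun_prop) (by fun_prop) s
    have hb := (hasDerivAt_sphereProfile (d := d) (ρ s)).comp s (hρd s)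
    have hfun : (fun s => ∫ ω, 1 * Real.cos (2 * Real.pi * (R * ω 0) + s * (2 * Real.pi * ω k))
      ∂unitSphereMeasure d) = sphereProfile d ∘ ρ := funext hG
    rw [hfun] at ha
    simpa using ha.unique hb
  have ha := (hasDerivAt_integral_sin (d := d) (A := fun ω => -(2 * Real.pi * ω k))
      (a := fun ω => 2 * Real.pi * (R * ω 0)) (b := fun ω => 2 * Real.pi * ω k)
      (by fun_prop) (by fun_prop) (by fun_prop) 0)
  have hfun : (fun s => ∫ ω, -(2 * Real.pi * ω k) *
      Real.sin (2 * Real.pi * (R * ω 0) + s * (2 * Real.pi * ω k)) ∂unitSphereMeasure d)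
        = fun s => (sphereProfileDeriv d (ρ s) / ρ s) * s := by
    funext s
    simp only [neg_mul]
    rw [h1 s]
    ring
  rw [hfun] at ha
  have hb := (((hasDerivAt_sphereProfileDeriv (d := d) (ρ 0)).comp 0 (hρd 0)).div (hρd 0)
    (by rw [hρ0]; exact hR.ne')).mul (hasDerivAt_id (0 : ℝ))
  have := ha.unique hb
  simp only [hρ0, zero_mul, add_zero, Function.comp, id, mul_zero, zero_add, mul_one,
    Pi.div_apply] at this
  rw [← this, ← integral_neg]
  refine integral_congr_ae (Filter.Eventually.of_forall fun ω => ?_)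
  simp only
  ring

/-- The Bessel equation: `R g'' + (d - 1) g' + (2 π) ^ 2 R g = 0`. -/
theorem sphereProfile_ode {R : ℝ} (hR : 0 < R) :
    -∫ ω, (2 * Real.pi) ^ 2 * (ω 0) ^ 2 * Real.cos (2 * Real.pi * (R * ω 0)) ∂unitSphereMeasure d
      = -(((d : ℝ) - 1) * sphereProfileDeriv d R / R) - (2 * Real.pi) ^ 2 * sphereProfile d R := by
  -- on the sphere the squares of the coordinates sum to `1`
  have hsum : ∑ k : Fin d, ∫ ω, (2 * Real.pi) ^ 2 * (ω k) ^ 2 *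
      Real.cos (2 * Real.pi * (R * ω 0)) ∂unitSphereMeasure d
        = (2 * Real.pi) ^ 2 * sphereProfile d R := by
    rw [← integral_finsetSum _ fun k _ =>
      integrable_unitSphereMeasure_of_continuous (by fun_prop)]
    unfold sphereProfile
    rw [← integral_const_mul]
    refine integral_congr_ae ?_
    filter_upwards [ae_norm_eq_one_unitSphereMeasure d] with ω hω
    have : ∑ k, (ω k) ^ 2 = 1 := by
      have := EuclideanSpace.norm_sq_eq ω
      simp only [hω, Real.norm_eq_abs, sq_abs] at this
      linarith
    rw [← Finset.sum_mul, ← Finset.mul_sum, this, mul_one]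
  rw [← Finset.add_sum_erase _ _ (Finset.mem_univ (0 : Fin d)),
    Finset.sum_congr rfl (fun k hk => integral_sq_coord_mul_cos (Finset.ne_of_mem_erase hk) hR),
    Finset.sum_const, Finset.card_erase_of_mem (Finset.mem_univ _), Finset.card_univ,
    Fintype.card_fin, nsmul_eq_mul, Nat.cast_sub (NeZero.one_le), Nat.cast_one] at hsum
  rw [← hsum]
  ring

/-- The energy `R ^ (d - 1) ((g' + (d - 1) / (2 R) g) ^ 2 + (2 π) ^ 2 g ^ 2)` of the normalized
solution `R ^ ((d - 1) / 2) g R` of the Bessel equation, `g = sphereProfile d`. -/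
noncomputable def sphereEnergy (d : ℕ) [NeZero d] (R : ℝ) : ℝ :=
  R ^ (d - 1) * ((sphereProfileDeriv d R + ((d - 1 : ℕ) : ℝ) / 2 * (sphereProfile d R / R)) ^ 2 +
    (2 * Real.pi) ^ 2 * sphereProfile d R ^ 2)

/-- In normalized form the Bessel equation is `h'' = (-(2 π) ^ 2 + c / R ^ 2) h`, so only the
integrable perturbation `c / R ^ 2` contributes to the derivative of the energy. -/
theorem hasDerivAt_sphereEnergy {R : ℝ} (hR : 0 < R) :
    HasDerivAt (sphereEnergy d)
      (R ^ (d - 1) * (2 * (((d - 1 : ℕ) : ℝ) / 2 * (((d - 1 : ℕ) : ℝ) / 2 - 1) / R ^ 2) *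
        sphereProfile d R *
        (sphereProfileDeriv d R + ((d - 1 : ℕ) : ℝ) / 2 * (sphereProfile d R / R)))) R := by
  have hg := hasDerivAt_sphereProfile (d := d) R
  have hg' := hasDerivAt_sphereProfileDeriv (d := d) R
  rw [sphereProfile_ode hR] at hg'
  have hp : HasDerivAt (fun R : ℝ => R ^ (d - 1)) (((d - 1 : ℕ) : ℝ) * R ^ (d - 1) / R) R := by
    refine (hasDerivAt_pow (d - 1) R).congr_deriv ?_
    rcases Nat.eq_zero_or_pos (d - 1) with h | h
    · simp [h]
    · obtain ⟨m, hm⟩ := Nat.exists_eq_add_of_lt h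
      simp only [zero_add] at hm
      rw [hm]
      simp only [Nat.add_sub_cancel]
      rw [pow_succ, eq_div_iff hR.ne']
      ring
  have hu := hg'.add ((hg.div (hasDerivAt_id' R) hR.ne').const_mul (((d - 1 : ℕ) : ℝ) / 2))
  have h := hp.mul ((hu.pow 2).add ((hg.pow 2).const_mul ((2 * Real.pi) ^ 2)))
  refine h.congr_deriv ?_
  have hd : (d : ℝ) - 1 = ((d - 1 : ℕ) : ℝ) := by
    rw [Nat.cast_sub NeZero.one_le, Nat.cast_one]
  simp only [Pi.add_apply, Pi.div_apply, Pi.pow_apply, hd, Nat.add_one_sub_one, pow_one]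
  field_simp
  ring

theorem exists_sphereEnergy_le :
    ∃ M, 0 ≤ M ∧ ∀ R, 1 ≤ R → sphereEnergy d R ≤ M := by
  set c : ℝ := ((d - 1 : ℕ) : ℝ) / 2 * (((d - 1 : ℕ) : ℝ) / 2 - 1) with hc
  have hE0 : ∀ R, 0 < R → 0 ≤ sphereEnergy d R := by
    intro R hR
    unfold sphereEnergy
    positivity
  -- the derivative of `exp (|c| / R)` absorbs the term `c / R ^ 2`, which is integrable at infinity
  have hanti : AntitoneOn (fun R => sphereEnergy d R * Real.exp (|c| / R)) (Ici 1) := by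
    have hder : ∀ R : ℝ, 0 < R → HasDerivAt (fun R => sphereEnergy d R * Real.exp (|c| / R)) _ R :=
      fun R hR => (hasDerivAt_sphereEnergy hR).mul
        (((hasDerivAt_const R |c|).div (hasDerivAt_id' R) hR.ne').exp)
    refine antitoneOn_of_deriv_nonpos (convex_Ici 1)
      (fun R hR => (hder R (lt_of_lt_of_le one_pos hR)).continuousAt.continuousWithinAt)
      (fun R hR => ?_) (fun R hR => ?_)
    · rw [interior_Ici] at hR
      exact (hder R (one_pos.trans hR)).differentiableAt.differentiableWithinAt
    · rw [interior_Ici] at hR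
      have hR0 : 0 < R := one_pos.trans hR
      rw [(hder R hR0).deriv]
      set g := sphereProfile d R
      set u := sphereProfileDeriv d R + ((d - 1 : ℕ) : ℝ) / 2 * (g / R) with hu
      have hE : sphereEnergy d R = R ^ (d - 1) * (u ^ 2 + (2 * Real.pi) ^ 2 * g ^ 2) := rfl
      have h1 : c * (2 * g * u) ≤ |c| * (u ^ 2 + (2 * Real.pi) ^ 2 * g ^ 2) := by
        have hpi : g ^ 2 ≤ (2 * Real.pi) ^ 2 * g ^ 2 := by
          have : 1 ≤ (2 * Real.pi) ^ 2 := by nlinarith [Real.pi_gt_three]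
          nlinarith [sq_nonneg g]
        calc c * (2 * g * u) ≤ |c| * |2 * g * u| := by
              rw [← abs_mul]; exact le_abs_self _
          _ ≤ |c| * (u ^ 2 + (2 * Real.pi) ^ 2 * g ^ 2) := by
              gcongr
              rw [abs_le]
              constructor <;> nlinarith [sq_nonneg (g + u), sq_nonneg (g - u)]
      have h2 : 0 ≤ R ^ (d - 1) / R ^ 2 * Real.exp (|c| / R) := by positivity
      have h3 := mul_nonneg h2 (sub_nonneg.2 h1)
      simp only [Pi.div_apply, zero_mul, mul_one, zero_sub]
      rw [hE]
      have e : R ^ (d - 1) / R ^ 2 * Real.exp (|c| / R) *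
          (|c| * (u ^ 2 + (2 * Real.pi) ^ 2 * g ^ 2) - c * (2 * g * u)) =
        -(R ^ (d - 1) * (2 * (c / R ^ 2) * g * u) * Real.exp (|c| / R) +
          R ^ (d - 1) * (u ^ 2 + (2 * Real.pi) ^ 2 * g ^ 2) *
            (Real.exp (|c| / R) * (-|c| / R ^ 2))) := by
        ring
      linarith
  refine ⟨sphereEnergy d 1 * Real.exp |c|, mul_nonneg (hE0 1 one_pos) (Real.exp_pos _).le, ?_⟩
  intro R hR
  have h := hanti (mem_Ici.2 le_rfl) (mem_Ici.2 hR) hR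
  simp only [div_one] at h
  refine le_trans (le_mul_of_one_le_right (hE0 R (by linarith)) ?_) h
  rw [Real.one_le_exp_iff]
  positivity

/-- A bound for large `R` gives one for all `R ≥ 0`, by compactness of `[0, 1]`. -/
theorem exists_abs_le_mul_one_add_rpow {f : ℝ → ℝ} (hf : Continuous f) (n : ℕ) {M : ℝ}
    (hM : ∀ R, 1 ≤ R → R ^ n * f R ^ 2 ≤ M) :
    ∃ C, 0 ≤ C ∧ ∀ R, 0 ≤ R → |f R| ≤ C * (1 + R) ^ (-((n : ℝ) / 2)) := by
  obtain ⟨S, hS⟩ := (isCompact_Icc (a := (0 : ℝ)) (b := 1)).exists_bound_of_continuousOn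
    hf.continuousOn
  have hM0 : 0 ≤ M := le_trans (by positivity) (hM 1 le_rfl)
  set D := 2 ^ n * (M + S ^ 2) with hD
  have hsq : ∀ R, 0 ≤ R → (1 + R) ^ n * f R ^ 2 ≤ D := by
    intro R hR
    rcases le_total R 1 with h | h
    · have h1 : f R ^ 2 ≤ S ^ 2 := by
        have := hS R ⟨hR, h⟩
        rw [Real.norm_eq_abs] at this
        exact sq_le_sq' (by linarith [neg_abs_le (f R)]) ((le_abs_self _).trans this)
      calc (1 + R) ^ n * f R ^ 2 ≤ 2 ^ n * (M + S ^ 2) := by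
            gcongr <;> linarith
        _ = D := rfl
    · calc (1 + R) ^ n * f R ^ 2 ≤ (2 * R) ^ n * f R ^ 2 := by gcongr; linarith
        _ = 2 ^ n * (R ^ n * f R ^ 2) := by ring
        _ ≤ 2 ^ n * (M + S ^ 2) := by
            gcongr
            linarith [hM R h, sq_nonneg S]
  refine ⟨Real.sqrt D, Real.sqrt_nonneg _, fun R hR => ?_⟩
  have hD0 : 0 ≤ D := by positivity
  refine abs_le_of_sq_le_sq ?_ (by positivity)
  have hp : 0 < (1 + R) ^ n := by positivity
  rw [mul_pow, Real.sq_sqrt hD0, ← Real.rpow_natCast (_ ^ _) 2, ← Real.rpow_mul (by positivity)]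
  have : -((n : ℝ) / 2) * (2 : ℕ) = -(n : ℝ) := by push_cast; ring
  rw [this, Real.rpow_neg (by positivity), Real.rpow_natCast, ← div_eq_mul_inv, le_div_iff₀ hp]
  linarith [hsq R hR]

/-- The profile and its derivative are `O(R ^ (-(d - 1) / 2))`. -/
theorem exists_sphereProfile_decay (d : ℕ) [NeZero d] :
    ∃ C, 0 ≤ C ∧ ∀ R, 0 ≤ R →
      |sphereProfile d R| ≤ C * (1 + R) ^ (-(((d - 1 : ℕ) : ℝ) / 2)) ∧
      |sphereProfileDeriv d R| ≤ C * (1 + R) ^ (-(((d - 1 : ℕ) : ℝ) / 2)) := by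
  obtain ⟨M, hM0, hM⟩ := exists_sphereEnergy_le (d := d)
  set b : ℝ := ((d - 1 : ℕ) : ℝ) / 2 with hb
  have hpi : 1 ≤ (2 * Real.pi) ^ 2 := by nlinarith [Real.pi_gt_three]
  have hg : ∀ R, 1 ≤ R → R ^ (d - 1) * sphereProfile d R ^ 2 ≤ M := by
    intro R hR
    refine le_trans ?_ (hM R hR)
    unfold sphereEnergy
    gcongr
    nlinarith [sq_nonneg (sphereProfile d R), sq_nonneg (sphereProfileDeriv d R +
      ((d - 1 : ℕ) : ℝ) / 2 * (sphereProfile d R / R))]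
  have hg' : ∀ R, 1 ≤ R → R ^ (d - 1) * sphereProfileDeriv d R ^ 2 ≤ 2 * M + 2 * b ^ 2 * M := by
    intro R hR
    set u := sphereProfileDeriv d R + b * (sphereProfile d R / R) with hu
    have h1 : R ^ (d - 1) * u ^ 2 ≤ M := by
      refine le_trans ?_ (hM R hR)
      unfold sphereEnergy
      gcongr
      exact le_add_of_nonneg_right (by positivity)
    have h2 : (sphereProfile d R / R) ^ 2 ≤ sphereProfile d R ^ 2 := by
      rw [div_pow]
      exact div_le_self (sq_nonneg _) (one_le_pow₀ hR)
    have h3 : sphereProfileDeriv d R ^ 2 ≤ 2 * u ^ 2 + 2 * b ^ 2 * sphereProfile d R ^ 2 := by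
      have e : sphereProfileDeriv d R = u - b * (sphereProfile d R / R) := by rw [hu]; ring
      rw [e]
      nlinarith [sq_nonneg (u + b * (sphereProfile d R / R)),
        mul_le_mul_of_nonneg_left h2 (sq_nonneg b)]
    calc R ^ (d - 1) * sphereProfileDeriv d R ^ 2
        ≤ R ^ (d - 1) * (2 * u ^ 2 + 2 * b ^ 2 * sphereProfile d R ^ 2) := by gcongr
      _ = 2 * (R ^ (d - 1) * u ^ 2) + 2 * b ^ 2 * (R ^ (d - 1) * sphereProfile d R ^ 2) := by ring
      _ ≤ 2 * M + 2 * b ^ 2 * M := by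
          gcongr
          exact hg R hR
  obtain ⟨C₁, hC₁, h₁⟩ := exists_abs_le_mul_one_add_rpow
    (continuous_iff_continuousAt.2 fun R => (hasDerivAt_sphereProfile R).continuousAt) _ hg
  obtain ⟨C₂, hC₂, h₂⟩ := exists_abs_le_mul_one_add_rpow
    (continuous_iff_continuousAt.2 fun R => (hasDerivAt_sphereProfileDeriv R).continuousAt) _ hg'
  refine ⟨C₁ + C₂, by positivity, fun R hR => ⟨(h₁ R hR).trans ?_, (h₂ R hR).trans ?_⟩⟩
  · gcongr
    linarith
  · gcongr
    linarith

end Decay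

/-! ### The kernel of the difference operator and its frequency pieces -/

section Kernel

variable {d : ℕ}

theorem le_rpow_of_le_one_of_le {x y a : ℝ} (hy : 0 ≤ y) (h1 : x ≤ 1) (h : x ≤ y)
    (ha₀ : 0 ≤ a) (ha₁ : a ≤ 1) : x ≤ y ^ a := by
  rcases le_total y 1 with hy1 | hy1
  · exact h.trans (Real.self_le_rpow_of_le_one hy hy1 ha₁)
  · exact h1.trans (Real.one_le_rpow hy1 ha₀)

theorem abs_pow_sub_self_le {r t : ℝ} (hr₀ : 0 ≤ r) (hr₂ : r ≤ 2) (hrt : |r - 1| ≤ t) (n : ℕ) :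
    |r ^ n - r| ≤ (n * 2 ^ (n - 1) + 1) * t := by
  have ht : 0 ≤ t := (abs_nonneg _).trans hrt
  have h1 := abs_pow_sub_pow_le r 1 n
  have h2 : max |r| |1| ≤ 2 := max_le (by rwa [abs_of_nonneg hr₀]) (by norm_num)
  rw [one_pow] at h1
  have h3 : |r ^ n - 1| ≤ t * n * 2 ^ (n - 1) := by
    refine h1.trans ?_
    gcongr
  calc |r ^ n - r| = |(r ^ n - 1) - (r - 1)| := by ring_nf
    _ ≤ |r ^ n - 1| + |r - 1| := abs_sub _ _
    _ ≤ t * n * 2 ^ (n - 1) + t := add_le_add h3 hrt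
    _ = (n * 2 ^ (n - 1) + 1) * t := by ring

/-- The radial profile of the convolution kernel of `𝓕_{rS}^* 𝓕_{rS} - r 𝓕_S^* 𝓕_S`. -/
noncomputable def diffKernel (d : ℕ) [NeZero d] (r R : ℝ) : ℝ :=
  r ^ (d - 1) * sphereProfile d (r * R) - r * sphereProfile d R

theorem continuous_sphereProfile [NeZero d] : Continuous (sphereProfile d) :=
  continuous_iff_continuousAt.2 fun R => (hasDerivAt_sphereProfile R).continuousAt

theorem continuous_diffKernel [NeZero d] (r : ℝ) : Continuous (diffKernel d r) := by
  have := continuous_sphereProfile (d := d)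
  unfold diffKernel
  fun_prop

theorem exists_diffKernel_le (d : ℕ) [NeZero d] {r₀ a : ℝ} (hr₀ : 0 < r₀) (hr₁ : r₀ ≤ 1)
    (ha₀ : 0 ≤ a) (ha₁ : a ≤ 1) :
    ∃ C, 0 ≤ C ∧ ∀ r, r₀ ≤ r → r ≤ 2 → ∀ t, t ≤ 1 → |r - 1| ≤ t → ∀ R, 0 ≤ R →
      |diffKernel d r R| ≤ C * (t * (1 + R)) ^ a * (1 + R) ^ (-(((d - 1 : ℕ) : ℝ) / 2)) := by
  obtain ⟨C₀, hC₀, hC⟩ := exists_sphereProfile_decay d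
  set b : ℝ := ((d - 1 : ℕ) : ℝ) / 2 with hb
  have hb0 : 0 ≤ b := by positivity
  set C₁ := C₀ * r₀ ^ (-b) with hC₁
  have hC₁0 : 0 ≤ C₁ := by positivity
  -- the decay at a point `R'` comparable to `R`
  have hcomp : ∀ R R', 0 ≤ R → r₀ * R ≤ R' → C₀ * (1 + R') ^ (-b) ≤ C₁ * (1 + R) ^ (-b) := by
    intro R R' hR hR'
    rw [hC₁, mul_assoc, ← Real.mul_rpow hr₀.le (by positivity)]
    refine mul_le_mul_of_nonneg_left ?_ hC₀
    refine Real.rpow_le_rpow_of_nonpos (by positivity) ?_ (by linarith)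
    linarith
  set D : ℝ := ((d - 1 : ℕ) : ℝ) * 2 ^ (d - 1 - 1) + 1 with hD
  refine ⟨D * C₁ + 4 * C₁, by positivity, ?_⟩
  intro r hr hr2 t ht1 hrt R hR
  have hr0 : 0 ≤ r := hr₀.le.trans hr
  have ht : 0 ≤ t := (abs_nonneg _).trans hrt
  set w := (1 + R) ^ (-b) with hw
  have hw0 : 0 ≤ w := by positivity
  set T := (t * (1 + R)) ^ a with hT
  have htR : t ≤ t * (1 + R) := le_mul_of_one_le_right ht (by linarith)
  have htT : t ≤ T := le_rpow_of_le_one_of_le (by positivity) ht1 htR ha₀ ha₁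
  have hT0 : 0 ≤ T := ht.trans htT
  have hgr : |sphereProfile d (r * R)| ≤ C₁ * w :=
    (hC _ (by positivity)).1.trans (hcomp R _ hR (by gcongr))
  have hg : |sphereProfile d R| ≤ C₁ * w :=
    (hC _ hR).1.trans (hcomp R _ hR (mul_le_of_le_one_left hR hr₁))
  -- the trivial bound for `t (1 + R) ≥ 1`, the mean value theorem for `t (1 + R) ≤ 1`
  have hdiff : |sphereProfile d (r * R) - sphereProfile d R| ≤ 2 * C₁ * w * T := by
    have h1 : |sphereProfile d (r * R) - sphereProfile d R| ≤ 2 * C₁ * w := by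
      refine (abs_sub _ _).trans ?_
      linarith
    have h2 : |sphereProfile d (r * R) - sphereProfile d R| ≤ C₁ * w * (t * (1 + R)) := by
      have := (convex_Ici (r₀ * R)).norm_image_sub_le_of_norm_hasDerivWithin_le
        (f := sphereProfile d) (f' := sphereProfileDeriv d) (C := C₁ * w) (x := R) (y := r * R)
        (fun x _ => (hasDerivAt_sphereProfile x).hasDerivWithinAt)
        (fun x hx => (hC x (le_trans (by positivity) (mem_Ici.1 hx))).2.trans
          (hcomp R x hR (mem_Ici.1 hx)))
        (mem_Ici.2 (mul_le_of_le_one_left hR hr₁)) (mem_Ici.2 (by gcongr))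
      refine this.trans ?_
      have e : ‖r * R - R‖ = |r - 1| * R := by
        rw [Real.norm_eq_abs, ← sub_one_mul, abs_mul, abs_of_nonneg hR]
      rw [e]
      have : |r - 1| * R ≤ t * (1 + R) := by
        calc |r - 1| * R ≤ t * R := by gcongr
          _ ≤ t * (1 + R) := by gcongr; linarith
      gcongr
    rcases le_total (t * (1 + R)) 1 with h | h
    · have : t * (1 + R) ≤ T := le_rpow_of_le_one_of_le (by positivity) h le_rfl ha₀ ha₁
      calc _ ≤ C₁ * w * (t * (1 + R)) := h2
        _ ≤ 2 * C₁ * w * T := by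
          have : C₁ * w * (t * (1 + R)) ≤ C₁ * w * T := by gcongr
          have : 0 ≤ C₁ * w * T := by positivity
          linarith
    · exact h1.trans (le_mul_of_one_le_right (by positivity) (Real.one_le_rpow h ha₀))
  calc |diffKernel d r R|
      = |(r ^ (d - 1) - r) * sphereProfile d (r * R)
          + r * (sphereProfile d (r * R) - sphereProfile d R)| := by
        unfold diffKernel
        ring_nf
    _ ≤ |r ^ (d - 1) - r| * |sphereProfile d (r * R)|
          + r * |sphereProfile d (r * R) - sphereProfile d R| := by
        refine (abs_add_le _ _).trans ?_
        rw [abs_mul, abs_mul r, abs_of_nonneg hr0]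
    _ ≤ D * T * (C₁ * w) + 2 * (2 * C₁ * w * T) := by
        have := (abs_pow_sub_self_le hr0 hr2 hrt (d - 1)).trans
          (mul_le_mul_of_nonneg_left htT (by positivity))
        gcongr
    _ = (D * C₁ + 4 * C₁) * T * w := by ring

theorem SchwartzMap.exists_norm_le_decayWeight (Ψ : 𝓢(EuclideanSpace ℝ (Fin d), ℂ)) :
    ∃ C, 0 ≤ C ∧ ∀ x, ‖Ψ x‖ ≤ C * decayWeight d x ∧ ‖fderiv ℝ Ψ x‖ ≤ C * decayWeight d x := by
  set C := 2 ^ (d + 1) * ((Finset.Iic (d + 1, 1)).sup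
    fun m => SchwartzMap.seminorm ℝ m.1 m.2) Ψ with hC
  have hw : ∀ x : EuclideanSpace ℝ (Fin d), ∀ y : ℝ, (1 + ‖x‖) ^ (d + 1) * y ≤ C →
      y ≤ C * decayWeight d x := by
    intro x y h
    unfold decayWeight
    rw [Real.rpow_neg (by positivity), ← div_eq_mul_inv, le_div_iff₀ (by positivity)]
    have : (1 + ‖x‖) ^ ((d : ℝ) + 1) = (1 + ‖x‖) ^ (d + 1) := by
      rw [← Real.rpow_natCast]
      norm_cast
    rw [this]
    linarith
  refine ⟨C, by positivity, fun x => ⟨hw x _ ?_, hw x _ ?_⟩⟩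
  · simpa using SchwartzMap.one_add_le_sup_seminorm_apply (𝕜 := ℝ) (m := (d + 1, 1)) (k := d + 1)
      (n := 0) le_rfl (Nat.zero_le _) Ψ x
  · simpa [norm_iteratedFDeriv_one] using SchwartzMap.one_add_le_sup_seminorm_apply (𝕜 := ℝ)
      (m := (d + 1, 1)) (k := d + 1) (n := 1) le_rfl le_rfl Ψ x

/-- Weighted Hölder continuity: the mean value theorem when `‖x - y‖ ≤ 1`, the triangle inequality
otherwise. -/
theorem SchwartzMap.exists_norm_sub_le_decayWeight (Ψ : 𝓢(EuclideanSpace ℝ (Fin d), ℂ)) {a : ℝ}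
    (ha₀ : 0 ≤ a) (ha₁ : a ≤ 1) :
    ∃ C, 0 ≤ C ∧ ∀ x, ‖Ψ x‖ ≤ C * decayWeight d x ∧
      ∀ y, ‖Ψ x - Ψ y‖ ≤ C * ‖x - y‖ ^ a * (decayWeight d x + decayWeight d y) := by
  obtain ⟨C, hC0, hC⟩ := Ψ.exists_norm_le_decayWeight
  have h2 : (1 : ℝ) ≤ 2 ^ (d + 1) := one_le_pow₀ (by norm_num)
  refine ⟨C * 2 ^ (d + 1), by positivity, fun x => ⟨(hC x).1.trans ?_, fun y => ?_⟩⟩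
  · have := (decayWeight_pos d x).le
    gcongr
    exact le_mul_of_one_le_right hC0 h2
  · have hx := (decayWeight_pos d x).le
    have hy := (decayWeight_pos d y).le
    rcases le_total ‖x - y‖ 1 with h | h
    · have hmv := (convex_segment (𝕜 := ℝ) y x).norm_image_sub_le_of_norm_fderiv_le (𝕜 := ℝ)
        (f := Ψ) (C := C * (2 ^ (d + 1) * decayWeight d y)) (x := y) (y := x)
        (fun z _ => Ψ.differentiableAt) (fun z hz => (hC z).2.trans ?_)
        (left_mem_segment ℝ y x) (right_mem_segment ℝ y x)
      · refine hmv.trans ?_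
        have : ‖x - y‖ ≤ ‖x - y‖ ^ a :=
          le_rpow_of_le_one_of_le (norm_nonneg _) h le_rfl ha₀ ha₁
        calc C * (2 ^ (d + 1) * decayWeight d y) * ‖x - y‖
            ≤ C * (2 ^ (d + 1) * (decayWeight d x + decayWeight d y)) * ‖x - y‖ ^ a := by
              gcongr
              linarith
          _ = _ := by ring
      · gcongr
        refine decayWeight_le (le_trans ?_ h)
        exact norm_sub_le_of_mem_segment hz
    · calc ‖Ψ x - Ψ y‖ ≤ ‖Ψ x‖ + ‖Ψ y‖ := norm_sub_le _ _
        _ ≤ C * decayWeight d x + C * decayWeight d y := add_le_add (hC x).1 (hC y).1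
        _ = C * 1 * 1 * (decayWeight d x + decayWeight d y) := by ring
        _ ≤ C * 2 ^ (d + 1) * ‖x - y‖ ^ a * (decayWeight d x + decayWeight d y) := by
            have := Real.one_le_rpow h ha₀
            gcongr

/-- The convolution of the surface measure of `r S` (without the Jacobian) with the `L¹`
normalized dilation `lam ^ d * Ψ (lam • ·)`. -/
noncomputable def sphereMultiplier (Ψ : 𝓢(EuclideanSpace ℝ (Fin d), ℂ)) (lam r : ℝ)
    (ξ : EuclideanSpace ℝ (Fin d)) : ℂ :=
  ∫ ω, (lam : ℂ) ^ d * Ψ (lam • (ξ - r • ω)) ∂unitSphereMeasure d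

theorem integrable_prod_sphereMultiplier (Ψ : 𝓢(EuclideanSpace ℝ (Fin d), ℂ)) {lam : ℝ}
    (hlam : 0 < lam) (r : ℝ) :
    Integrable (Function.uncurry fun ξ ω : EuclideanSpace ℝ (Fin d) =>
      (lam : ℂ) ^ d * Ψ (lam • (ξ - r • ω))) (volume.prod (unitSphereMeasure d)) := by
  have hc : Continuous (Function.uncurry fun ξ ω : EuclideanSpace ℝ (Fin d) =>
      (lam : ℂ) ^ d * Ψ (lam • (ξ - r • ω))) := by
    have := Ψ.continuous
    unfold Function.uncurry
    fun_prop
  have hi : ∀ ω : EuclideanSpace ℝ (Fin d), Integrable (fun ξ => Ψ (lam • (ξ - ω))) := fun ω =>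
    (Ψ.integrable.comp_smul hlam.ne').comp_sub_right ω
  rw [integrable_prod_iff' hc.aestronglyMeasurable]
  refine ⟨Filter.Eventually.of_forall fun ω => (hi (r • ω)).const_mul _, ?_⟩
  have : ∀ ω : EuclideanSpace ℝ (Fin d), ∫ ξ, ‖(lam : ℂ) ^ d * Ψ (lam • (ξ - r • ω))‖
      = ∫ ξ, ‖(lam : ℂ) ^ d * Ψ (lam • ξ)‖ := fun ω =>
    integral_sub_right_eq_self (fun ξ => ‖(lam : ℂ) ^ d * Ψ (lam • ξ)‖) (r • ω)
  simp only [Function.uncurry, this]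
  exact integrable_const _

theorem integrable_sphereMultiplier (Ψ : 𝓢(EuclideanSpace ℝ (Fin d), ℂ)) {lam : ℝ}
    (hlam : 0 < lam) (r : ℝ) : Integrable (sphereMultiplier Ψ lam r) :=
  (integrable_prod_sphereMultiplier Ψ hlam r).integral_prod_left

end Kernel

section Multiplier

variable {d : ℕ}

theorem norm_exp_two_pi_I_mul (x : ℝ) : ‖Complex.exp (2 * Real.pi * Complex.I * x)‖ = 1 := by
  rw [← Complex.norm_exp_ofReal_mul_I (2 * Real.pi * x)]
  congr 2
  push_cast
  ring

theorem integral_dilate_mul_exp (Ψ : 𝓢(EuclideanSpace ℝ (Fin d), ℂ)) {lam : ℝ} (hlam : 0 < lam)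
    (x η : EuclideanSpace ℝ (Fin d)) :
    ∫ ξ, (lam : ℂ) ^ d * Ψ (lam • (ξ - η)) *
        Complex.exp (2 * Real.pi * Complex.I * (inner ℝ x ξ : ℝ))
      = Complex.exp (2 * Real.pi * Complex.I * (inner ℝ x η : ℝ)) *
        (𝓕⁻ Ψ : 𝓢(EuclideanSpace ℝ (Fin d), ℂ)) (lam⁻¹ • x) := by
  have h1 := integral_sub_right_eq_self (μ := (volume : Measure (EuclideanSpace ℝ (Fin d))))
    (fun ζ : EuclideanSpace ℝ (Fin d) => (lam : ℂ) ^ d * Ψ (lam • ζ) *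
      Complex.exp (2 * Real.pi * Complex.I * (inner ℝ x (ζ + η) : ℝ))) η
  simp only [sub_add_cancel] at h1
  rw [h1]
  have h2 := Measure.integral_comp_smul (volume : Measure (EuclideanSpace ℝ (Fin d)))
    (fun z : EuclideanSpace ℝ (Fin d) => (lam : ℂ) ^ d * Ψ z *
      Complex.exp (2 * Real.pi * Complex.I * (inner ℝ x (lam⁻¹ • z + η) : ℝ))) lam
  simp only [smul_smul, inv_mul_cancel₀ hlam.ne', one_smul] at h2
  rw [h2, SchwartzMap.fourierInv_coe, Real.fourierInv_eq', ← integral_const_mul, ← integral_smul]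
  refine integral_congr_ae (Filter.Eventually.of_forall fun z => ?_)
  have hl : (lam : ℂ) ≠ 0 := by exact_mod_cast hlam.ne'
  simp only [finrank_euclideanSpace, Fintype.card_fin, Complex.real_smul, smul_eq_mul,
    inner_add_right, inner_smul_right, real_inner_comm]
  rw [abs_of_pos (by positivity)]
  push_cast
  rw [mul_add, Complex.exp_add]
  have : 2 * (Real.pi : ℂ) * Complex.I * ((lam : ℂ)⁻¹ * (inner ℝ x z : ℝ)) =
    2 * Real.pi * ((lam : ℂ)⁻¹ * (inner ℝ x z : ℝ)) * Complex.I := by ring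
  rw [this]
  field_simp

/-- The inverse Fourier transform of `sphereMultiplier` is the inverse transform of the surface
measure, cut off at scale `lam`. -/
theorem integral_sphereMultiplier_mul_exp [NeZero d] (Ψ : 𝓢(EuclideanSpace ℝ (Fin d), ℂ))
    {lam r : ℝ} (hlam : 0 < lam) (hr : 0 ≤ r) (x : EuclideanSpace ℝ (Fin d)) :
    ∫ ξ, sphereMultiplier Ψ lam r ξ * Complex.exp (2 * Real.pi * Complex.I * (inner ℝ x ξ : ℝ))
      = sphereProfile d (r * ‖x‖) *
        (𝓕⁻ Ψ : 𝓢(EuclideanSpace ℝ (Fin d), ℂ)) (lam⁻¹ • x) := by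
  unfold sphereMultiplier
  simp only [← integral_mul_const]
  rw [integral_integral_swap]
  · simp only [integral_dilate_mul_exp Ψ hlam]
    rw [integral_mul_const]
    have := integral_exp_inner_eq_sphereProfile (r • x)
    rw [norm_smul, Real.norm_of_nonneg hr] at this
    rw [← this]
    simp only [inner_smul_left, inner_smul_right, RCLike.conj_to_real]
  · refine (integrable_prod_sphereMultiplier Ψ hlam r).mono ?_ ?_
    · refine Continuous.aestronglyMeasurable ?_
      have := Ψ.continuous
      unfold Function.uncurry
      fun_prop
    · refine Filter.Eventually.of_forall fun p => ?_
      simp only [Function.uncurry, norm_mul, norm_exp_two_pi_I_mul, mul_one, le_refl]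

/-- The Fourier multiplier of the kernel `diffKernel`, cut off at scale `lam`. -/
noncomputable def diffMultiplier (Ψ : 𝓢(EuclideanSpace ℝ (Fin d), ℂ)) (lam r : ℝ)
    (ξ : EuclideanSpace ℝ (Fin d)) : ℂ :=
  (r : ℂ) ^ (d - 1) * sphereMultiplier Ψ lam r ξ - r * sphereMultiplier Ψ lam 1 ξ

theorem integrable_diffMultiplier (Ψ : 𝓢(EuclideanSpace ℝ (Fin d), ℂ)) {lam : ℝ}
    (hlam : 0 < lam) (r : ℝ) : Integrable (diffMultiplier Ψ lam r) :=
  ((integrable_sphereMultiplier Ψ hlam r).const_mul _).sub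
    ((integrable_sphereMultiplier Ψ hlam 1).const_mul _)

theorem MeasureTheory.Integrable.mul_exp_inner {f : EuclideanSpace ℝ (Fin d) → ℂ}
    {μ : Measure (EuclideanSpace ℝ (Fin d))}
    (hf : Integrable f μ) (x : EuclideanSpace ℝ (Fin d)) :
    Integrable (fun ξ => f ξ * Complex.exp (2 * Real.pi * Complex.I * (inner ℝ x ξ : ℝ))) μ := by
  refine hf.mono (hf.1.mul (Continuous.aestronglyMeasurable (by fun_prop))) ?_
  refine Filter.Eventually.of_forall fun ξ => ?_
  rw [norm_mul, norm_exp_two_pi_I_mul, mul_one]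

theorem integral_diffMultiplier_mul_exp [NeZero d] (Ψ : 𝓢(EuclideanSpace ℝ (Fin d), ℂ))
    {lam r : ℝ} (hlam : 0 < lam) (hr : 0 ≤ r) (x : EuclideanSpace ℝ (Fin d)) :
    ∫ ξ, diffMultiplier Ψ lam r ξ * Complex.exp (2 * Real.pi * Complex.I * (inner ℝ x ξ : ℝ))
      = diffKernel d r ‖x‖ * (𝓕⁻ Ψ : 𝓢(EuclideanSpace ℝ (Fin d), ℂ)) (lam⁻¹ • x) := by
  unfold diffMultiplier
  simp only [sub_mul, mul_assoc _ (sphereMultiplier _ _ _ _) _]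
  rw [integral_sub (((integrable_sphereMultiplier Ψ hlam r).mul_exp_inner x).const_mul _)
    (((integrable_sphereMultiplier Ψ hlam 1).mul_exp_inner x).const_mul _), integral_const_mul,
    integral_const_mul]
  have h1 := integral_sphereMultiplier_mul_exp Ψ hlam hr x
  have h2 := integral_sphereMultiplier_mul_exp Ψ hlam zero_le_one x
  rw [h1, h2, diffKernel, one_mul]
  push_cast
  ring

/-- Corresponding points of the two spheres are at distance at most `t`, that is `t * lam` in the
units of the dilated `Ψ`; what is left is the mass `O(lam)` of the weight on each sphere. -/
theorem exists_diffMultiplier_le (Ψ : 𝓢(EuclideanSpace ℝ (Fin d), ℂ)) {r₀ a : ℝ}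
    (hr₀ : 0 < r₀) (hr₁ : r₀ ≤ 1) (ha₀ : 0 ≤ a) (ha₁ : a ≤ 1) :
    ∃ C, 0 ≤ C ∧ ∀ r, r₀ ≤ r → r ≤ 2 → ∀ t, t ≤ 1 → |r - 1| ≤ t → ∀ lam, 1 ≤ lam →
      ∀ ξ, ‖diffMultiplier Ψ lam r ξ‖ ≤ C * (t * lam) ^ a * lam := by
  obtain ⟨C₁, hC₁0, hC₁⟩ := Ψ.exists_norm_sub_le_decayWeight ha₀ ha₁
  obtain ⟨C₂, hC₂0, hC₂⟩ := exists_integral_decayWeight_sphere_le d hr₀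
  set D : ℝ := ((d - 1 : ℕ) : ℝ) * 2 ^ (d - 1 - 1) + 1 with hD
  refine ⟨(D * C₁ + 2 * C₁) * (2 * C₂), by positivity, ?_⟩
  intro r hr hr2 t ht1 hrt lam hlam ξ
  have hlam0 : 0 < lam := by linarith
  have hr0 : 0 ≤ r := hr₀.le.trans hr
  have ht : 0 ≤ t := (abs_nonneg _).trans hrt
  set T := (t * lam) ^ a with hT
  have htT : t ≤ T := le_rpow_of_le_one_of_le (by positivity) ht1
    (le_mul_of_one_le_right ht hlam) ha₀ ha₁
  have hT0 : 0 ≤ T := ht.trans htT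
  have hΨ := Ψ.continuous
  set P : EuclideanSpace ℝ (Fin d) → ℝ := fun ω =>
    decayWeight d (lam • (ξ - r • ω)) + decayWeight d (lam • (ξ - (1 : ℝ) • ω)) with hP
  have hint : ∀ s : ℝ, Integrable (fun ω : EuclideanSpace ℝ (Fin d) =>
      decayWeight d (lam • (ξ - s • ω))) (unitSphereMeasure d) := fun s =>
    integrable_unitSphereMeasure_of_continuous (by fun_prop)
  have hPint : ∫ ω, P ω ∂unitSphereMeasure d
      = ∫ ω, decayWeight d (lam • (ξ - r • ω)) ∂unitSphereMeasure d
        + ∫ ω, decayWeight d (lam • (ξ - (1 : ℝ) • ω)) ∂unitSphereMeasure d :=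
    integral_add (hint r) (hint 1)
  have heq : diffMultiplier Ψ lam r ξ = ∫ ω, (lam : ℂ) ^ d *
      ((r : ℂ) ^ (d - 1) * Ψ (lam • (ξ - r • ω)) - r * Ψ (lam • (ξ - (1 : ℝ) • ω)))
        ∂unitSphereMeasure d := by
    unfold diffMultiplier sphereMultiplier
    rw [← integral_const_mul, ← integral_const_mul, ← integral_sub
      (integrable_unitSphereMeasure_of_continuous (by fun_prop))
      (integrable_unitSphereMeasure_of_continuous (by fun_prop))]
    refine integral_congr_ae (Filter.Eventually.of_forall fun ω => ?_)
    simp only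
    ring
  rw [heq]
  have hbound : ∀ᵐ ω ∂unitSphereMeasure d, ‖(lam : ℂ) ^ d *
      ((r : ℂ) ^ (d - 1) * Ψ (lam • (ξ - r • ω)) - r * Ψ (lam • (ξ - (1 : ℝ) • ω)))‖
        ≤ lam ^ d * ((D * C₁ + 2 * C₁) * T * P ω) := by
    filter_upwards [ae_norm_eq_one_unitSphereMeasure d] with ω hω
    rw [norm_mul, norm_pow, Complex.norm_real, Real.norm_of_nonneg hlam0.le]
    gcongr
    set x := lam • (ξ - r • ω) with hx
    set y := lam • (ξ - (1 : ℝ) • ω) with hy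
    have hxw := (decayWeight_pos d x).le
    have hyw := (decayWeight_pos d y).le
    have hxy : ‖x - y‖ ≤ t * lam := by
      rw [hx, hy, ← smul_sub, sub_sub_sub_cancel_left, ← sub_smul, norm_smul, norm_smul, hω,
        mul_one, Real.norm_of_nonneg hlam0.le, Real.norm_eq_abs, abs_sub_comm, mul_comm]
      gcongr
    have hxyT : ‖x - y‖ ^ a ≤ T := Real.rpow_le_rpow (norm_nonneg _) hxy ha₀
    calc ‖(r : ℂ) ^ (d - 1) * Ψ x - r * Ψ y‖
        = ‖((r ^ (d - 1) - r : ℝ) : ℂ) * Ψ x + (r : ℂ) * (Ψ x - Ψ y)‖ := by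
          push_cast
          ring_nf
      _ ≤ |r ^ (d - 1) - r| * ‖Ψ x‖ + r * ‖Ψ x - Ψ y‖ := by
          refine (norm_add_le _ _).trans ?_
          rw [norm_mul, norm_mul, Complex.norm_real, Complex.norm_real, Real.norm_eq_abs,
            Real.norm_of_nonneg hr0]
      _ ≤ D * T * (C₁ * decayWeight d x)
            + 2 * (C₁ * T * (decayWeight d x + decayWeight d y)) := by
          have h1 := (abs_pow_sub_self_le hr0 hr2 hrt (d - 1)).trans
            (mul_le_mul_of_nonneg_left htT (by positivity))
          have h2 := (hC₁ x).1
          have h3 : ‖Ψ x - Ψ y‖ ≤ C₁ * T * (decayWeight d x + decayWeight d y) :=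
            ((hC₁ x).2 y).trans (by gcongr)
          gcongr
      _ ≤ D * T * (C₁ * (decayWeight d x + decayWeight d y))
            + 2 * (C₁ * T * (decayWeight d x + decayWeight d y)) := by
          gcongr
          linarith
      _ = (D * C₁ + 2 * C₁) * T * (decayWeight d x + decayWeight d y) := by ring
  refine (norm_integral_le_of_norm_le ?_ hbound).trans ?_
  · exact (((hint r).add (hint 1)).const_mul _).const_mul _
  · rw [integral_const_mul, integral_const_mul, hPint]
    have h1 := hC₂ r hr lam hlam ξ
    have h2 := hC₂ 1 hr₁ lam hlam ξ
    calc _ = (D * C₁ + 2 * C₁) * T *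
          (lam ^ d * ∫ ω, decayWeight d (lam • (ξ - r • ω)) ∂unitSphereMeasure d
            + lam ^ d * ∫ ω, decayWeight d (lam • (ξ - (1 : ℝ) • ω)) ∂unitSphereMeasure d) := by
          ring
      _ ≤ (D * C₁ + 2 * C₁) * T * (C₂ * lam + C₂ * lam) := by gcongr
      _ = (D * C₁ + 2 * C₁) * (2 * C₂) * T * lam := by ring

end Multiplier

/-! ### Convolution forms on `L²` -/

section Plancherel

variable {d : ℕ}

/-- On `L¹ ∩ L²` the Fourier integral agrees with the Fourier transform on `L²`. -/
theorem fourier_ae_eq_fourier_toLp {f : EuclideanSpace ℝ (Fin d) → ℂ} (hf : Integrable f)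
    (hf2 : MemLp f 2) : 𝓕 f =ᵐ[volume] (𝓕 (hf2.toLp f) : Lp ℂ 2 volume) := by
  refine ae_eq_of_integral_contDiff_smul_eq ?_ ?_ ?_
  · refine Continuous.locallyIntegrable ?_
    exact VectorFourier.fourierIntegral_continuous Real.continuous_fourierChar
      continuous_inner hf
  · exact (Lp.memLp _).locallyIntegrable (by norm_num)
  · intro g hg hgs
    have hg' : ContDiff ℝ (⊤ : ℕ∞) (fun x => (g x : ℂ)) := Complex.ofRealCLM.contDiff.comp hg
    have hgs' : HasCompactSupport (fun x => (g x : ℂ)) :=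
      hgs.comp_left (g := fun x : ℝ => (x : ℂ)) (by simp)
    set G : 𝓢(EuclideanSpace ℝ (Fin d), ℂ) := hgs'.toSchwartzMap hg' with hG
    have hGg : ∀ x, G x = (g x : ℂ) := fun x => rfl
    have h1 : ∫ x, g x • (𝓕 (hf2.toLp f) : Lp ℂ 2 volume) x = ∫ x, (𝓕 G) x • f x := by
      have h := congrArg (fun u : 𝓢'(EuclideanSpace ℝ (Fin d), ℂ) => u G)
        (Lp.fourier_toTemperedDistribution_eq (hf2.toLp f))
      simp only [TemperedDistribution.fourier_apply, Lp.toTemperedDistribution_apply] at h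
      have h' : ∫ x, (𝓕 G) x • (hf2.toLp f) x = ∫ x, (𝓕 G) x • f x := by
        refine integral_congr_ae ?_
        filter_upwards [hf2.coeFn_toLp] with x hx
        rw [hx]
      rw [← h', h]
      refine integral_congr_ae (Filter.Eventually.of_forall fun x => ?_)
      simp [hGg]
    rw [h1]
    have h2 := VectorFourier.integral_fourierIntegral_smul_eq_flip (μ := volume) (ν := volume)
      (L := innerₗ (EuclideanSpace ℝ (Fin d))) (e := Real.fourierChar)
      Real.continuous_fourierChar continuous_inner hf G.integrable
    rw [flip_innerₗ] at h2
    rw [SchwartzMap.fourier_coe]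
    calc ∫ x, g x • 𝓕 f x = ∫ x, 𝓕 f x • G x := by
          refine integral_congr_ae (Filter.Eventually.of_forall fun x => ?_)
          simp [hGg, mul_comm]
      _ = ∫ x, f x • (𝓕 (G : EuclideanSpace ℝ (Fin d) → ℂ)) x := h2
      _ = _ := by simp only [smul_eq_mul, mul_comm]

theorem memLp_fourier {f : EuclideanSpace ℝ (Fin d) → ℂ} (hf : Integrable f)
    (hf2 : MemLp f 2) : MemLp (𝓕 f) 2 :=
  (memLp_congr_ae (fourier_ae_eq_fourier_toLp hf hf2)).2 (Lp.memLp _)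

theorem eLpNorm_fourier_eq {f : EuclideanSpace ℝ (Fin d) → ℂ} (hf : Integrable f)
    (hf2 : MemLp f 2) : eLpNorm (𝓕 f) 2 = eLpNorm f 2 := by
  rw [eLpNorm_congr_ae (fourier_ae_eq_fourier_toLp hf hf2),
    ← eLpNorm_congr_ae hf2.coeFn_toLp]
  have h := Lp.norm_fourier_eq (hf2.toLp f)
  rw [Lp.norm_def, Lp.norm_def] at h
  exact (ENNReal.toReal_eq_toReal_iff' (Lp.eLpNorm_ne_top _) (Lp.eLpNorm_ne_top _)).1 h

theorem integral_norm_fourier_rpow_two {f : EuclideanSpace ℝ (Fin d) → ℂ} (hf : Integrable f)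
    (hf2 : MemLp f 2) : ∫ ξ, ‖𝓕 f ξ‖ ^ (2 : ℝ) = ∫ x, ‖f x‖ ^ (2 : ℝ) := by
  have h := eLpNorm_fourier_eq hf hf2
  rw [(memLp_fourier hf hf2).eLpNorm_eq_integral_rpow_norm (by norm_num) (by norm_num),
    hf2.eLpNorm_eq_integral_rpow_norm (by norm_num) (by norm_num)] at h
  have hn : ∀ u : EuclideanSpace ℝ (Fin d) → ℂ, 0 ≤ ∫ x, ‖u x‖ ^ (2 : ℝ≥0∞).toReal :=
    fun u => integral_nonneg fun x => by positivity
  rw [ENNReal.ofReal_eq_ofReal_iff (by have := hn (𝓕 f); positivity)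
    (by have := hn f; positivity)] at h
  have := (Real.rpow_left_inj (hn (𝓕 f)) (hn f) (by norm_num)).1 h
  simpa using this

/-- The convolution form `∬ k (x - y) f y g x dx dy`. -/
noncomputable def convForm (k f g : EuclideanSpace ℝ (Fin d) → ℂ) : ℂ :=
  ∫ z : EuclideanSpace ℝ (Fin d) × EuclideanSpace ℝ (Fin d), k (z.1 - z.2) * (g z.1 * f z.2)

/-- If `k` is the inverse Fourier transform of `m`, the form is diagonal in frequency. -/
theorem convForm_eq_integral_multiplier {k m f g : EuclideanSpace ℝ (Fin d) → ℂ}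
    (hm : Integrable m) (hf : Integrable f) (hg : Integrable g)
    (hk : ∀ x, k x = ∫ ξ, m ξ * Complex.exp (2 * Real.pi * Complex.I * (inner ℝ x ξ : ℝ))) :
    convForm k f g = ∫ ξ, m ξ * (𝓕⁻ g ξ * 𝓕 f ξ) := by
  unfold convForm
  simp only [hk, ← integral_mul_const]
  rw [integral_integral_swap]
  · refine integral_congr_ae (Filter.Eventually.of_forall fun ξ => ?_)
    simp only [mul_assoc (m ξ)]
    rw [integral_const_mul, Real.fourierInv_eq', Real.fourier_eq']
    congr 1
    rw [Measure.volume_eq_prod, ← integral_prod_mul]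
    refine integral_congr_ae (Filter.Eventually.of_forall fun z => ?_)
    simp only [inner_sub_left, smul_eq_mul]
    have : 2 * Real.pi * Complex.I * ((inner ℝ z.1 ξ - inner ℝ z.2 ξ : ℝ) : ℂ)
        = ((2 * Real.pi * inner ℝ z.1 ξ : ℝ) : ℂ) * Complex.I
          + ((-2 * Real.pi * inner ℝ z.2 ξ : ℝ) : ℂ) * Complex.I := by
      push_cast
      ring
    rw [this, Complex.exp_add]
    ring
  · have h := (hg.mul_prod hf).mul_prod hm
    refine h.mono ?_ ?_
    · have he : Continuous fun p : (EuclideanSpace ℝ (Fin d) × EuclideanSpace ℝ (Fin d)) ×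
          EuclideanSpace ℝ (Fin d) =>
          Complex.exp (2 * Real.pi * Complex.I * (inner ℝ (p.1.1 - p.1.2) p.2 : ℝ)) := by
        fun_prop
      refine (h.1.mul he.aestronglyMeasurable).congr (Filter.Eventually.of_forall fun p => ?_)
      simp only [Function.uncurry, Pi.mul_apply]
      ring
    · refine Filter.Eventually.of_forall fun p => ?_
      simp only [Function.uncurry, norm_mul, norm_exp_two_pi_I_mul, mul_one]
      exact le_of_eq (by ring)

theorem norm_convForm_le_of_multiplier {k m f g : EuclideanSpace ℝ (Fin d) → ℂ} {M : ℝ}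
    (hm : Integrable m) (hf : Integrable f) (hg : Integrable g)
    (hf2 : MemLp f 2) (hg2 : MemLp g 2)
    (hk : ∀ x, k x = ∫ ξ, m ξ * Complex.exp (2 * Real.pi * Complex.I * (inner ℝ x ξ : ℝ)))
    (hM : ∀ ξ, ‖m ξ‖ ≤ M) :
    ‖convForm k f g‖ ≤ M * ((∫ x, ‖f x‖ ^ (2 : ℝ)) ^ (1 / 2 : ℝ) *
      (∫ x, ‖g x‖ ^ (2 : ℝ)) ^ (1 / 2 : ℝ)) := by
  have hM0 : 0 ≤ M := (norm_nonneg _).trans (hM 0)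
  rw [convForm_eq_integral_multiplier hm hf hg hk]
  have hginv : 𝓕⁻ g = fun ξ => 𝓕 g (-ξ) := by
    funext ξ
    exact Real.fourierInv_eq_fourier_neg g ξ
  have hF := memLp_fourier hf hf2
  have hG : MemLp (𝓕⁻ g) 2 := by
    rw [hginv]
    exact (memLp_fourier hg hg2).comp_measurePreserving (Measure.measurePreserving_neg volume)
  have hGn : ∫ ξ, ‖𝓕⁻ g ξ‖ ^ (2 : ℝ) = ∫ x, ‖g x‖ ^ (2 : ℝ) := by
    rw [← integral_norm_fourier_rpow_two hg hg2, hginv]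
    exact integral_neg_eq_self (fun ξ => ‖𝓕 g ξ‖ ^ (2 : ℝ)) volume
  have hol := integral_mul_norm_le_Lp_mul_Lq (μ := volume) (p := 2) (q := 2) (f := 𝓕⁻ g)
    (g := 𝓕 f) (by constructor <;> norm_num) (by simpa using hG) (by simpa using hF)
  have hint : Integrable (fun ξ => ‖𝓕⁻ g ξ‖ * ‖𝓕 f ξ‖) :=
    MemLp.integrable_mul hG.norm hF.norm
  refine (norm_integral_le_of_norm_le (hint.const_mul M)
    (Filter.Eventually.of_forall fun ξ => ?_)).trans ?_
  · rw [norm_mul, norm_mul]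
    gcongr
    exact hM ξ
  · rw [integral_const_mul]
    rw [hGn, integral_norm_fourier_rpow_two hf hf2] at hol
    rw [mul_comm ((∫ x, ‖f x‖ ^ (2 : ℝ)) ^ (1 / 2 : ℝ))]
    gcongr

end Plancherel

/-! ### Interpolation of convolution forms -/

section Interpolation

variable {d : ℕ}

/-- The analytic family `(a / |a|) |a| ^ (p (1 + z) / 2)` through `a`, which is attained at
`z = 2 / p - 1`; its modulus is `|a| ^ (p / 2)` on `re z = 0` and `|a| ^ p` on `re z = 1`. -/
noncomputable def interpWeight (p : ℝ) (z a : ℂ) : ℂ :=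
  if a = 0 then 0 else a / ‖a‖ * (‖a‖ : ℂ) ^ ((p : ℂ) * (1 + z) / 2)

@[simp]
theorem interpWeight_zero (p : ℝ) (z : ℂ) : interpWeight p z 0 = 0 := by simp [interpWeight]

theorem norm_interpWeight {p : ℝ} {z a : ℂ} (ha : a ≠ 0) :
    ‖interpWeight p z a‖ = ‖a‖ ^ (p * (1 + z.re) / 2) := by
  have h : 0 < ‖a‖ := norm_pos_iff.2 ha
  have e : ((p : ℂ) * (1 + z) / 2).re = p * (1 + z.re) / 2 := by
    rw [Complex.div_ofNat_re, Complex.re_ofReal_mul]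
    simp
  rw [interpWeight, if_neg ha, norm_mul, norm_div, Complex.norm_real, norm_norm, div_self h.ne',
    one_mul, Complex.norm_cpow_eq_rpow_re_of_pos h, e]

theorem norm_interpWeight_rpow_two {p : ℝ} (hp : 0 < p) {z : ℂ} (hz : z.re = 0) (a : ℂ) :
    ‖interpWeight p z a‖ ^ (2 : ℝ) = ‖a‖ ^ p := by
  by_cases ha : a = 0
  · simp [ha, Real.zero_rpow hp.ne']
  · rw [norm_interpWeight ha, hz, ← Real.rpow_mul (norm_nonneg _)]
    ring_nf

theorem norm_interpWeight_of_re_eq_one {p : ℝ} (hp : 0 < p) {z : ℂ} (hz : z.re = 1) (a : ℂ) :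
    ‖interpWeight p z a‖ = ‖a‖ ^ p := by
  by_cases ha : a = 0
  · simp [ha, Real.zero_rpow hp.ne']
  · rw [norm_interpWeight ha, hz]
    ring_nf

theorem norm_interpWeight_le {p : ℝ} (hp : 0 < p) {z : ℂ} (h0 : 0 ≤ z.re) (h1 : z.re ≤ 1) (a : ℂ) :
    ‖interpWeight p z a‖ ≤ (1 + ‖a‖) ^ p := by
  by_cases ha : a = 0
  · simp [ha]
  · rw [norm_interpWeight ha]
    calc ‖a‖ ^ (p * (1 + z.re) / 2) ≤ (1 + ‖a‖) ^ (p * (1 + z.re) / 2) := by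
          have : 0 ≤ p * (1 + z.re) / 2 := by positivity
          gcongr
          linarith
      _ ≤ (1 + ‖a‖) ^ p := by
          refine Real.rpow_le_rpow_of_exponent_le (by linarith [norm_nonneg a]) ?_
          nlinarith

theorem interpWeight_eq_self {p : ℝ} (hp : 0 < p) (a : ℂ) :
    interpWeight p ((2 / p - 1 : ℝ) : ℂ) a = a := by
  by_cases ha : a = 0
  · simp [ha]
  · have h : (‖a‖ : ℂ) ≠ 0 := by simpa using ha
    have hp' : (p : ℂ) ≠ 0 := by exact_mod_cast hp.ne'
    have e : (p : ℂ) * (1 + ((2 / p - 1 : ℝ) : ℂ)) / 2 = 1 := by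
      push_cast
      field_simp
      ring
    rw [interpWeight, if_neg ha, e, Complex.cpow_one, div_mul_cancel₀ _ h]

theorem differentiable_interpWeight (p : ℝ) (a : ℂ) :
    Differentiable ℂ (fun z => interpWeight p z a) := by
  by_cases ha : a = 0
  · simp [ha]
  · have h : (‖a‖ : ℂ) ≠ 0 := by simpa using ha
    have e : (fun z => interpWeight p z a)
        = fun z => a / ‖a‖ * (‖a‖ : ℂ) ^ ((p : ℂ) * (1 + z) / 2) := by
      funext z
      rw [interpWeight, if_neg ha]
    rw [e]
    intro z
    refine DifferentiableAt.const_mul ?_ _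
    exact DifferentiableAt.const_cpow (by fun_prop) (Or.inl h)

theorem norm_convForm_le {k f g : EuclideanSpace ℝ (Fin d) → ℂ} {S : ℝ}
    (hf : Integrable f) (hg : Integrable g) (hS : ∀ x, ‖k x‖ ≤ S) :
    ‖convForm k f g‖ ≤ S * ((∫ x, ‖f x‖) * ∫ x, ‖g x‖) := by
  have h := (hg.norm.mul_prod hf.norm).const_mul S
  refine (norm_integral_le_of_norm_le h (Filter.Eventually.of_forall fun z => ?_)).trans ?_
  · rw [norm_mul, norm_mul]
    gcongr
    exact hS _
  · rw [integral_const_mul, integral_prod_mul (fun x => ‖g x‖) (fun x => ‖f x‖),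
      mul_comm (∫ x, ‖g x‖)]

theorem integrable_convForm {k f g : EuclideanSpace ℝ (Fin d) → ℂ} {S : ℝ}
    (hkm : Measurable k) (hS : ∀ x, ‖k x‖ ≤ S) (hf : Integrable f) (hg : Integrable g) :
    Integrable (fun z : EuclideanSpace ℝ (Fin d) × EuclideanSpace ℝ (Fin d) =>
      k (z.1 - z.2) * (g z.1 * f z.2)) :=
  (hg.mul_prod hf).bdd_mul (c := S)
    (hkm.comp (measurable_fst.sub measurable_snd)).aestronglyMeasurable (Filter.Eventually.of_forall fun _ => hS _)

/-- Expansion over level sets. The level set of `0` may have infinite measure; its coefficient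
`w 0 = 0` makes the corresponding terms vanish. -/
theorem convForm_map_eq_sum {k : EuclideanSpace ℝ (Fin d) → ℂ} {S : ℝ}
    (hkm : Measurable k) (hS : ∀ x, ‖k x‖ ≤ S)
    (f g : SimpleFunc (EuclideanSpace ℝ (Fin d)) ℂ) (hf : Integrable f) (hg : Integrable g)
    {w : ℂ → ℂ} (hw : w 0 = 0) :
    convForm k (f.map w) (g.map w) = ∑ a ∈ f.range, ∑ b ∈ g.range, w b * w a *
      convForm k ((f ⁻¹' {a}).indicator 1) ((g ⁻¹' {b}).indicator 1) := by
  have hind : ∀ (h : SimpleFunc (EuclideanSpace ℝ (Fin d)) ℂ) (x : EuclideanSpace ℝ (Fin d)),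
      h.map w x = ∑ a ∈ h.range, w a * (h ⁻¹' {a}).indicator 1 x := by
    intro h x
    rw [Finset.sum_eq_single (h x)]
    · simp
    · intro a _ ha
      have : x ∉ h ⁻¹' {a} := fun hx => ha (by simpa using hx.symm)
      simp [this]
    · intro hx
      exact absurd (SimpleFunc.mem_range_self h x) hx
  have hint : ∀ h : SimpleFunc (EuclideanSpace ℝ (Fin d)) ℂ, Integrable h → ∀ a, a ≠ 0 →
      Integrable ((h ⁻¹' {a}).indicator (1 : EuclideanSpace ℝ (Fin d) → ℂ)) := by
    intro h hh a ha
    refine IntegrableOn.integrable_indicator ?_ (h.measurableSet_fiber a)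
    refine integrableOn_const (C := (1 : ℂ)) ?_
    exact (SimpleFunc.measure_preimage_lt_top_of_integrable h hh ha).ne
  unfold convForm
  have hterm : ∀ a b, Integrable (fun z : EuclideanSpace ℝ (Fin d) × EuclideanSpace ℝ (Fin d) =>
      w b * w a * (k (z.1 - z.2) * ((g ⁻¹' {b}).indicator 1 z.1 * (f ⁻¹' {a}).indicator 1 z.2))) := by
    intro a b
    by_cases ha : a = 0
    · simp [ha, hw]
    by_cases hb : b = 0
    · simp [hb, hw]
    exact (integrable_convForm hkm hS (hint f hf a ha) (hint g hg b hb)).const_mul _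
  simp only [← integral_const_mul]
  rw [Finset.sum_congr rfl fun a _ => (integral_finsetSum _ fun b _ => hterm a b).symm,
    ← integral_finsetSum _ fun a _ => integrable_finsetSum _ fun b _ => hterm a b]
  refine integral_congr_ae (Filter.Eventually.of_forall fun z => ?_)
  simp only [hind]
  rw [Finset.sum_comm, Finset.sum_mul_sum, Finset.mul_sum]
  refine Finset.sum_congr rfl fun b _ => ?_
  rw [Finset.mul_sum]
  refine Finset.sum_congr rfl fun a _ => ?_
  ring

/-- Riesz–Thorin interpolation between `L¹ × L¹` and `L² × L²`, for simple functions. -/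
theorem norm_convForm_simpleFunc_le {k : EuclideanSpace ℝ (Fin d) → ℂ} {S M p : ℝ}
    (hkm : Measurable k) (hS0 : 0 ≤ S) (hS : ∀ x, ‖k x‖ ≤ S) (hM0 : 0 ≤ M)
    (hM : ∀ f g : EuclideanSpace ℝ (Fin d) → ℂ, Integrable f → Integrable g → MemLp f 2 →
      MemLp g 2 → ‖convForm k f g‖ ≤ M * ((∫ x, ‖f x‖ ^ (2 : ℝ)) ^ (1 / 2 : ℝ) *
        (∫ x, ‖g x‖ ^ (2 : ℝ)) ^ (1 / 2 : ℝ)))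
    (hp1 : 1 ≤ p) (hp2 : p ≤ 2) (f g : SimpleFunc (EuclideanSpace ℝ (Fin d)) ℂ)
    (hf : Integrable f) (hg : Integrable g) :
    ‖convForm k f g‖ ≤ M ^ (2 - 2 / p) * S ^ (2 / p - 1) *
      ((∫ x, ‖f x‖ ^ p) ^ (1 / p) * (∫ x, ‖g x‖ ^ p) ^ (1 / p)) := by
  have hp0 : 0 < p := by linarith
  set θ : ℝ := 2 / p - 1 with hθ
  have hθ0 : 0 ≤ θ := by
    rw [hθ, sub_nonneg, le_div_iff₀ hp0]
    linarith
  have hθ1 : θ ≤ 1 := by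
    rw [hθ, sub_le_iff_le_add, div_le_iff₀ hp0]
    linarith
  set Nf := ∫ x, ‖f x‖ ^ p with hNf
  set Ng := ∫ x, ‖g x‖ ^ p with hNg
  have hNf0 : 0 ≤ Nf := integral_nonneg fun x => by positivity
  have hNg0 : 0 ≤ Ng := integral_nonneg fun x => by positivity
  set F : ℂ → ℂ := fun z => convForm k (f.map (interpWeight p z)) (g.map (interpWeight p z))
    with hF
  have hFsum : ∀ z, F z = ∑ a ∈ f.range, ∑ b ∈ g.range, interpWeight p z b * interpWeight p z a *
      convForm k ((f ⁻¹' {a}).indicator 1) ((g ⁻¹' {b}).indicator 1) := fun z =>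
    convForm_map_eq_sum hkm hS f g hf hg (interpWeight_zero p z)
  have hFd : Differentiable ℂ F := by
    rw [funext hFsum]
    have := differentiable_interpWeight p
    fun_prop
  have hmap : ∀ (h : SimpleFunc (EuclideanSpace ℝ (Fin d)) ℂ) (z : ℂ), Integrable h →
      Integrable (h.map (interpWeight p z)) := by
    intro h z hh
    rw [SimpleFunc.integrable_iff_finMeasSupp] at hh ⊢
    exact hh.map (interpWeight_zero p z)
  have hmap2 : ∀ (h : SimpleFunc (EuclideanSpace ℝ (Fin d)) ℂ) (z : ℂ), Integrable h →
      MemLp (h.map (interpWeight p z)) 2 := fun h z hh =>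
    (SimpleFunc.memLp_iff_integrable (by norm_num) (by norm_num)).2 (hmap h z hh)
  have h3 := Complex.HadamardThreeLines.norm_le_interp_of_mem_verticalClosedStrip₀₁' F
    (z := (θ : ℂ)) (a := M * (Nf ^ (1 / 2 : ℝ) * Ng ^ (1 / 2 : ℝ))) (b := S * (Nf * Ng))
    (by
      rw [Complex.HadamardThreeLines.verticalClosedStrip]
      simp [hθ0, hθ1])
    hFd.diffContOnCl
    (by
      refine ⟨∑ a ∈ f.range, ∑ b ∈ g.range, (1 + ‖b‖) ^ p * (1 + ‖a‖) ^ p *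
        ‖convForm k ((f ⁻¹' {a}).indicator 1) ((g ⁻¹' {b}).indicator 1)‖, ?_⟩
      rintro _ ⟨z, hz, rfl⟩
      rw [Complex.HadamardThreeLines.verticalClosedStrip, mem_preimage, mem_Icc] at hz
      simp only [Function.comp, hFsum]
      refine (norm_sum_le _ _).trans (Finset.sum_le_sum fun a _ => ?_)
      refine (norm_sum_le _ _).trans (Finset.sum_le_sum fun b _ => ?_)
      rw [norm_mul, norm_mul]
      gcongr
      · exact norm_interpWeight_le hp0 hz.1 hz.2 b
      · exact norm_interpWeight_le hp0 hz.1 hz.2 a)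
    (by
      intro z hz
      have hz' : z.re = 0 := hz
      have h := hM _ _ (hmap f z hf) (hmap g z hg) (hmap2 f z hf) (hmap2 g z hg)
      simpa only [SimpleFunc.map_apply, norm_interpWeight_rpow_two hp0 hz'] using h)
    (by
      intro z hz
      have hz' : z.re = 1 := hz
      have h := norm_convForm_le (hmap f z hf) (hmap g z hg) hS
      simpa only [SimpleFunc.map_apply, norm_interpWeight_of_re_eq_one hp0 hz'] using h)
  have hFθ : F θ = convForm k f g := by
    rw [hF, hθ]
    simp only [SimpleFunc.coe_map, Function.comp_def, interpWeight_eq_self hp0]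
  rw [hFθ, Complex.ofReal_re] at h3
  refine h3.trans (le_of_eq ?_)
  have e1 : 1 - θ = 2 - 2 / p := by rw [hθ]; ring
  have e2 : ∀ x : ℝ, 0 ≤ x → (x ^ (1 / 2 : ℝ)) ^ (1 - θ) * x ^ θ = x ^ (1 / p) := by
    intro x hx
    rw [← Real.rpow_mul hx, ← Real.rpow_add_of_nonneg hx (by linarith) hθ0]
    congr 1
    rw [hθ]
    field_simp
    ring
  rw [Real.mul_rpow hM0 (by positivity), Real.mul_rpow (by positivity) (by positivity),
    Real.mul_rpow hS0 (by positivity), Real.mul_rpow hNf0 hNg0, ← e2 _ hNf0, ← e2 _ hNg0, ← e1]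
  ring

/-- Riesz–Thorin interpolation for convolution forms. The factor `4` comes from the approximation
of `f` and `g` by simple functions of at most twice their modulus. -/
theorem norm_convForm_le_interp {k : EuclideanSpace ℝ (Fin d) → ℂ} {S M p : ℝ}
    (hkm : Measurable k) (hS0 : 0 ≤ S) (hS : ∀ x, ‖k x‖ ≤ S) (hM0 : 0 ≤ M)
    (hM : ∀ f g : EuclideanSpace ℝ (Fin d) → ℂ, Integrable f → Integrable g → MemLp f 2 →
      MemLp g 2 → ‖convForm k f g‖ ≤ M * ((∫ x, ‖f x‖ ^ (2 : ℝ)) ^ (1 / 2 : ℝ) *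
        (∫ x, ‖g x‖ ^ (2 : ℝ)) ^ (1 / 2 : ℝ)))
    (hp1 : 1 ≤ p) (hp2 : p ≤ 2) {f g : EuclideanSpace ℝ (Fin d) → ℂ}
    (hfm : Measurable f) (hgm : Measurable g)
    (hf : Integrable f) (hg : Integrable g) (hfp : Integrable fun x => ‖f x‖ ^ p)
    (hgp : Integrable fun x => ‖g x‖ ^ p) :
    ‖convForm k f g‖ ≤ 4 * (M ^ (2 - 2 / p) * S ^ (2 / p - 1)) *
      ((∫ x, ‖f x‖ ^ p) ^ (1 / p) * (∫ x, ‖g x‖ ^ p) ^ (1 / p)) := by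
  have hp0 : 0 < p := by linarith
  set φ : ℕ → SimpleFunc (EuclideanSpace ℝ (Fin d)) ℂ :=
    SimpleFunc.approxOn f hfm univ 0 (mem_univ _) with hφ
  set γ : ℕ → SimpleFunc (EuclideanSpace ℝ (Fin d)) ℂ :=
    SimpleFunc.approxOn g hgm univ 0 (mem_univ _) with hγ
  have hφ2 : ∀ n x, ‖φ n x‖ ≤ 2 * ‖f x‖ := fun n x => by
    rw [two_mul]; exact SimpleFunc.norm_approxOn_zero_le hfm (mem_univ _) x n
  have hγ2 : ∀ n x, ‖γ n x‖ ≤ 2 * ‖g x‖ := fun n x => by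
    rw [two_mul]; exact SimpleFunc.norm_approxOn_zero_le hgm (mem_univ _) x n
  have hφi : ∀ n, Integrable (φ n) := fun n =>
    (hf.const_mul 2).mono (φ n).aestronglyMeasurable
      (Filter.Eventually.of_forall fun x => (hφ2 n x).trans (by simp))
  have hγi : ∀ n, Integrable (γ n) := fun n =>
    (hg.const_mul 2).mono (γ n).aestronglyMeasurable
      (Filter.Eventually.of_forall fun x => (hγ2 n x).trans (by simp))
  have hpow : ∀ (h : SimpleFunc (EuclideanSpace ℝ (Fin d)) ℂ) (u : EuclideanSpace ℝ (Fin d) → ℂ),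
      (∀ x, ‖h x‖ ≤ 2 * ‖u x‖) → Integrable (fun x => ‖u x‖ ^ p) →
      (∫ x, ‖h x‖ ^ p) ^ (1 / p) ≤ 2 * (∫ x, ‖u x‖ ^ p) ^ (1 / p) := by
    intro h u hu hup
    have h1 : ∫ x, ‖h x‖ ^ p ≤ 2 ^ p * ∫ x, ‖u x‖ ^ p := by
      rw [← integral_const_mul]
      refine integral_mono_of_nonneg (Filter.Eventually.of_forall fun x => by positivity)
        (hup.const_mul _) (Filter.Eventually.of_forall fun x => ?_)
      simp only
      rw [← Real.mul_rpow (by norm_num) (norm_nonneg _)]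
      gcongr
      exact hu x
    have hn : 0 ≤ ∫ x, ‖u x‖ ^ p := integral_nonneg fun x => by positivity
    calc (∫ x, ‖h x‖ ^ p) ^ (1 / p) ≤ (2 ^ p * ∫ x, ‖u x‖ ^ p) ^ (1 / p) := by
          have : 0 ≤ ∫ x, ‖h x‖ ^ p := integral_nonneg fun x => by positivity
          gcongr
      _ = 2 * (∫ x, ‖u x‖ ^ p) ^ (1 / p) := by
          rw [Real.mul_rpow (by positivity) hn, ← Real.rpow_mul (by norm_num),
            mul_one_div_cancel hp0.ne', Real.rpow_one]
  have hlim : Filter.Tendsto (fun n => convForm k (φ n) (γ n)) Filter.atTop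
      (nhds (convForm k f g)) := by
    refine tendsto_integral_of_dominated_convergence
      (fun z : EuclideanSpace ℝ (Fin d) × EuclideanSpace ℝ (Fin d) =>
        S * ((2 * ‖g z.1‖) * (2 * ‖f z.2‖)))
      (fun n => (integrable_convForm hkm hS (hφi n) (hγi n)).1)
      (((hg.norm.const_mul 2).mul_prod (hf.norm.const_mul 2)).const_mul S)
      (fun n => Filter.Eventually.of_forall fun z => ?_)
      (Filter.Eventually.of_forall fun z => ?_)
    · rw [norm_mul, norm_mul]
      have := hφ2 n z.2
      have := hγ2 n z.1
      have := hS (z.1 - z.2)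
      gcongr
    · refine Filter.Tendsto.const_mul _ (Filter.Tendsto.mul ?_ ?_)
      · exact SimpleFunc.tendsto_approxOn hgm (mem_univ _) (by simp)
      · exact SimpleFunc.tendsto_approxOn hfm (mem_univ _) (by simp)
  refine le_of_tendsto hlim.norm (Filter.Eventually.of_forall fun n => ?_)
  refine (norm_convForm_simpleFunc_le hkm hS0 hS hM0 hM hp1 hp2 (φ n) (γ n) (hφi n) (hγi n)).trans ?_
  have h1 := hpow (φ n) f (hφ2 n) hfp
  have h2 := hpow (γ n) g (hγ2 n) hgp
  have : 0 ≤ ∫ x, ‖γ n x‖ ^ p := integral_nonneg fun x => by positivity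
  calc _ ≤ M ^ (2 - 2 / p) * S ^ (2 / p - 1) *
        ((2 * (∫ x, ‖f x‖ ^ p) ^ (1 / p)) * (2 * (∫ x, ‖g x‖ ^ p) ^ (1 / p))) := by gcongr
    _ = _ := by ring

end Interpolation

/-! ### Dyadic decomposition of the kernel -/

section Dyadic

variable {d : ℕ}

/-- A single piece of the kernel, cut off where `1 + ‖x‖` is comparable to `lam`. -/
theorem exists_norm_convForm_piece_le [NeZero d] (η : 𝓢(EuclideanSpace ℝ (Fin d), ℂ))
    (hη : ∀ x, ‖η x‖ ≤ 1) {r₀ a p : ℝ} (hr₀ : 0 < r₀) (hr₁ : r₀ ≤ 1) (ha₀ : 0 ≤ a) (ha₁ : a ≤ 1)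
    (hp1 : 1 ≤ p) (hp2 : p ≤ 2) :
    ∃ C, 0 ≤ C ∧ ∀ r, r₀ ≤ r → r ≤ 2 → ∀ t, t ≤ 1 → |r - 1| ≤ t → ∀ lam, 1 ≤ lam →
      (∀ x, η (lam⁻¹ • x) ≠ 0 → lam / 2 ≤ 1 + ‖x‖ ∧ 1 + ‖x‖ ≤ 3 * lam) →
      ∀ f g : EuclideanSpace ℝ (Fin d) → ℂ, Measurable f → Measurable g → Integrable f →
        Integrable g → Integrable (fun x => ‖f x‖ ^ p) → Integrable (fun x => ‖g x‖ ^ p) →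
        ‖convForm (fun x => diffKernel d r ‖x‖ * η (lam⁻¹ • x)) f g‖ ≤
          C * t ^ a * lam ^ (a + 1 - (2 / p - 1) * (((d : ℝ) + 1) / 2)) *
            ((∫ x, ‖f x‖ ^ p) ^ (1 / p) * (∫ x, ‖g x‖ ^ p) ^ (1 / p)) := by
  have hp0 : 0 < p := by linarith
  obtain ⟨C₁, hC₁0, hC₁⟩ := exists_diffMultiplier_le (𝓕 η) hr₀ hr₁ ha₀ ha₁
  obtain ⟨C₂, hC₂0, hC₂⟩ := exists_diffKernel_le d hr₀ hr₁ ha₀ ha₁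
  set b : ℝ := ((d - 1 : ℕ) : ℝ) / 2 with hb
  have hbd : b = ((d : ℝ) - 1) / 2 := by rw [hb, Nat.cast_sub NeZero.one_le, Nat.cast_one]
  have hb0 : 0 ≤ b := by positivity
  set θ : ℝ := 2 / p - 1 with hθ
  have hθ0 : 0 ≤ θ := by
    rw [hθ, sub_nonneg, le_div_iff₀ hp0]
    linarith
  have hθ1 : θ ≤ 1 := by
    rw [hθ, sub_le_iff_le_add, div_le_iff₀ hp0]
    linarith
  refine ⟨4 * (C₁ ^ (1 - θ) * (C₂ * 3 ^ a * 2 ^ b) ^ θ), by positivity, ?_⟩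
  intro r hr hr2 t ht1 hrt lam hlam hsupp f g hfm hgm hf hg hfp hgp
  have hlam0 : 0 < lam := by linarith
  have ht : 0 ≤ t := (abs_nonneg _).trans hrt
  have hr0 : 0 ≤ r := hr₀.le.trans hr
  set k : EuclideanSpace ℝ (Fin d) → ℂ := fun x => diffKernel d r ‖x‖ * η (lam⁻¹ • x) with hk
  have hkm : Measurable k := by
    apply Continuous.measurable
    have := continuous_diffKernel (d := d) r
    have := η.continuous
    fun_prop
  set S := C₂ * 3 ^ a * 2 ^ b * ((t * lam) ^ a * lam ^ (-b)) with hS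
  have hkS : ∀ x, ‖k x‖ ≤ S := by
    intro x
    by_cases hx : η (lam⁻¹ • x) = 0
    · simp only [hk, hx, mul_zero, norm_zero]
      positivity
    · obtain ⟨h1, h2⟩ := hsupp x hx
      have hpos : 0 < 1 + ‖x‖ := by positivity
      calc ‖k x‖ ≤ |diffKernel d r ‖x‖| * 1 := by
            rw [hk]
            simp only
            rw [norm_mul, Complex.norm_real, Real.norm_eq_abs]
            gcongr
            exact hη _
        _ ≤ C₂ * (t * (1 + ‖x‖)) ^ a * (1 + ‖x‖) ^ (-b) := by
            rw [mul_one]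
            exact hC₂ r hr hr2 t ht1 hrt _ (norm_nonneg _)
        _ ≤ C₂ * (3 * (t * lam)) ^ a * (lam / 2) ^ (-b) := by
            have e1 : (t * (1 + ‖x‖)) ^ a ≤ (3 * (t * lam)) ^ a := by
              refine Real.rpow_le_rpow (by positivity) ?_ ha₀
              calc t * (1 + ‖x‖) ≤ t * (3 * lam) := by gcongr
                _ = 3 * (t * lam) := by ring
            have e2 : (1 + ‖x‖) ^ (-b) ≤ (lam / 2) ^ (-b) :=
              Real.rpow_le_rpow_of_nonpos (by positivity) h1 (by linarith)
            gcongr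
        _ = S := by
            rw [Real.mul_rpow (by norm_num) (by positivity), Real.div_rpow hlam0.le (by norm_num),
              Real.rpow_neg (by norm_num : (0 : ℝ) ≤ 2), hS]
            field_simp
  have hM : ∀ ξ, ‖diffMultiplier (𝓕 η) lam r ξ‖ ≤ C₁ * (t * lam) ^ a * lam :=
    hC₁ r hr hr2 t ht1 hrt lam hlam
  have hkrep : ∀ x, k x = ∫ ξ, diffMultiplier (𝓕 η) lam r ξ *
      Complex.exp (2 * Real.pi * Complex.I * (inner ℝ x ξ : ℝ)) := by
    intro x
    rw [integral_diffMultiplier_mul_exp _ hlam0 hr0, FourierTransform.fourierInv_fourier_eq]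
  have hmain := norm_convForm_le_interp hkm ((norm_nonneg _).trans (hkS 0)) hkS (by positivity)
    (fun f g hf hg hf2 hg2 => norm_convForm_le_of_multiplier
      (integrable_diffMultiplier (𝓕 η) hlam0 r) hf hg hf2 hg2 hkrep hM)
    hp1 hp2 hfm hgm hf hg hfp hgp
  refine hmain.trans (le_of_eq ?_)
  congr 1
  have e1 : 2 - 2 / p = 1 - θ := by rw [hθ]; ring
  have ht' : 0 ≤ t ^ a := by positivity
  rw [e1, ← hθ, hS, mul_assoc C₁, Real.mul_rpow hC₁0 (by positivity),
    Real.mul_rpow (x := C₂ * 3 ^ a * 2 ^ b) (by positivity) (by positivity),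
    Real.mul_rpow ht hlam0.le]
  -- the powers of `t` and `lam` interpolate, with `(d - 1) / 2 + 1 = (d + 1) / 2`
  have e3 : (t ^ a * lam ^ a * lam) ^ (1 - θ) * (t ^ a * lam ^ a * lam ^ (-b)) ^ θ
      = t ^ a * lam ^ (a + 1 - θ * (((d : ℝ) + 1) / 2)) := by
    rw [mul_assoc, mul_assoc, Real.mul_rpow ht' (by positivity), Real.mul_rpow ht' (by positivity),
      ← Real.rpow_add_one hlam0.ne', ← Real.rpow_add hlam0, ← Real.rpow_mul hlam0.le,
      ← Real.rpow_mul hlam0.le]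
    have : (t ^ a) ^ (1 - θ) * (t ^ a) ^ θ = t ^ a := by
      rw [← Real.rpow_add_of_nonneg ht' (by linarith) hθ0]
      simp
    calc _ = ((t ^ a) ^ (1 - θ) * (t ^ a) ^ θ) *
          (lam ^ ((a + 1) * (1 - θ)) * lam ^ ((a + -b) * θ)) := by ring
      _ = _ := by
        rw [this, ← Real.rpow_add hlam0, hbd]
        congr 2
        ring
  calc _ = 4 * (C₁ ^ (1 - θ) * (C₂ * 3 ^ a * 2 ^ b) ^ θ) *
      ((t ^ a * lam ^ a * lam) ^ (1 - θ) * (t ^ a * lam ^ a * lam ^ (-b)) ^ θ) := by ring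
    _ = _ := by rw [e3]; ring

/-- A smooth radial cutoff: `1` on the unit ball, `0` outside the ball of radius `2`. -/
noncomputable def ballCutoff (d : ℕ) : ContDiffBump (0 : EuclideanSpace ℝ (Fin d)) :=
  ⟨1, 2, one_pos, one_lt_two⟩

/-- `ballCutoff` as a Schwartz function. -/
noncomputable def ballCutoffSchwartz (d : ℕ) : 𝓢(EuclideanSpace ℝ (Fin d), ℂ) :=
  HasCompactSupport.toSchwartzMap (f := fun x => ((ballCutoff d x : ℝ) : ℂ))
    ((ballCutoff d).hasCompactSupport.comp_left (g := fun x : ℝ => (x : ℂ)) (by simp))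
    (Complex.ofRealCLM.contDiff.comp (ballCutoff d).contDiff)

theorem ballCutoffSchwartz_apply (x : EuclideanSpace ℝ (Fin d)) :
    ballCutoffSchwartz d x = ((ballCutoff d x : ℝ) : ℂ) := rfl

theorem ballCutoff_eq_one {x : EuclideanSpace ℝ (Fin d)} (hx : ‖x‖ ≤ 1) : ballCutoff d x = 1 :=
  (ballCutoff d).one_of_mem_closedBall (by simpa [ballCutoff] using hx)

theorem ballCutoff_eq_zero {x : EuclideanSpace ℝ (Fin d)} (hx : 2 ≤ ‖x‖) : ballCutoff d x = 0 :=
  (ballCutoff d).zero_of_le_dist (by simpa [ballCutoff] using hx)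

theorem norm_ballCutoffSchwartz_le (x : EuclideanSpace ℝ (Fin d)) : ‖ballCutoffSchwartz d x‖ ≤ 1 := by
  rw [ballCutoffSchwartz_apply, Complex.norm_real, Real.norm_of_nonneg (ballCutoff d).nonneg]
  exact (ballCutoff d).le_one

theorem contDiff_annulusCutoff (d : ℕ) : ContDiff ℝ (⊤ : ℕ∞)
    (fun x : EuclideanSpace ℝ (Fin d) =>
      ((ballCutoff d x - ballCutoff d ((2 : ℝ) • x) : ℝ) : ℂ)) := by
  have h : ContDiff ℝ (⊤ : ℕ∞) (ballCutoff d) := (ballCutoff d).contDiff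
  have h2 : ContDiff ℝ (⊤ : ℕ∞) (fun x : EuclideanSpace ℝ (Fin d) => (2 : ℝ) • x) :=
    contDiff_const_smul 2
  exact Complex.ofRealCLM.contDiff.comp (h.sub (h.comp h2))

theorem hasCompactSupport_annulusCutoff (d : ℕ) : HasCompactSupport
    (fun x : EuclideanSpace ℝ (Fin d) =>
      ((ballCutoff d x - ballCutoff d ((2 : ℝ) • x) : ℝ) : ℂ)) := by
  refine HasCompactSupport.intro (isCompact_closedBall 0 2) fun x hx => ?_
  have hx' : 2 < ‖x‖ := by simpa using hx
  have h2 : ‖(2 : ℝ) • x‖ = 2 * ‖x‖ := by simp [norm_smul]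
  rw [ballCutoff_eq_zero hx'.le, ballCutoff_eq_zero (by linarith)]
  simp

/-- The dyadic cutoff `χ x - χ (2 x)`, `χ = ballCutoff`, as a Schwartz function. -/
noncomputable def annulusCutoffSchwartz (d : ℕ) : 𝓢(EuclideanSpace ℝ (Fin d), ℂ) :=
  (hasCompactSupport_annulusCutoff d).toSchwartzMap (contDiff_annulusCutoff d)

theorem annulusCutoffSchwartz_apply (x : EuclideanSpace ℝ (Fin d)) :
    annulusCutoffSchwartz d x = ((ballCutoff d x - ballCutoff d ((2 : ℝ) • x) : ℝ) : ℂ) := rfl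

theorem norm_annulusCutoffSchwartz_le (x : EuclideanSpace ℝ (Fin d)) :
    ‖annulusCutoffSchwartz d x‖ ≤ 1 := by
  rw [annulusCutoffSchwartz_apply, Complex.norm_real, Real.norm_eq_abs, abs_le]
  have h1 := (ballCutoff d).nonneg (x := x)
  have h2 := (ballCutoff d).le_one (x := x)
  have h3 := (ballCutoff d).nonneg (x := (2 : ℝ) • x)
  have h4 := (ballCutoff d).le_one (x := (2 : ℝ) • x)
  constructor <;> linarith

theorem norm_of_annulusCutoffSchwartz_ne_zero {x : EuclideanSpace ℝ (Fin d)}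
    (hx : annulusCutoffSchwartz d x ≠ 0) : 1 / 2 ≤ ‖x‖ ∧ ‖x‖ ≤ 2 := by
  have h2 : ‖(2 : ℝ) • x‖ = 2 * ‖x‖ := by simp [norm_smul]
  constructor
  · by_contra! h
    refine hx ?_
    rw [annulusCutoffSchwartz_apply, ballCutoff_eq_one (by linarith),
      ballCutoff_eq_one (by linarith)]
    simp
  · by_contra! h
    refine hx ?_
    rw [annulusCutoffSchwartz_apply, ballCutoff_eq_zero (by linarith),
      ballCutoff_eq_zero (by linarith)]
    simp

theorem exists_abs_sphereProfile_le [NeZero d] :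
    ∃ S, ∀ R, |sphereProfile d R| ≤ S := by
  refine ⟨(unitSphereMeasure d).real univ, fun R => ?_⟩
  have h := norm_integral_le_of_norm_le_const (μ := unitSphereMeasure d) (C := 1)
    (f := fun ω : EuclideanSpace ℝ (Fin d) => Real.cos (2 * Real.pi * (R * ω 0)))
    (Filter.Eventually.of_forall fun ω => Real.abs_cos_le_one _)
  rw [one_mul] at h
  exact h

theorem exists_abs_diffKernel_le_const [NeZero d] {r : ℝ} (hr : 0 ≤ r) :
    ∃ S, ∀ R, |diffKernel d r R| ≤ S := by
  obtain ⟨S, hS⟩ := exists_abs_sphereProfile_le (d := d)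
  refine ⟨r ^ (d - 1) * S + r * S, fun R => ?_⟩
  unfold diffKernel
  refine (abs_sub _ _).trans ?_
  rw [abs_mul, abs_mul, abs_of_nonneg (by positivity : 0 ≤ r ^ (d - 1)), abs_of_nonneg hr]
  gcongr
  · exact hS _
  · exact hS _

theorem convForm_add {k₁ k₂ f g : EuclideanSpace ℝ (Fin d) → ℂ} {S₁ S₂ : ℝ}
    (hk₁ : Measurable k₁) (hk₂ : Measurable k₂) (hS₁ : ∀ x, ‖k₁ x‖ ≤ S₁) (hS₂ : ∀ x, ‖k₂ x‖ ≤ S₂)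
    (hf : Integrable f) (hg : Integrable g) :
    convForm (fun x => k₁ x + k₂ x) f g = convForm k₁ f g + convForm k₂ f g := by
  unfold convForm
  rw [← integral_add (integrable_convForm hk₁ hS₁ hf hg) (integrable_convForm hk₂ hS₂ hf hg)]
  simp only [add_mul]

/-- The convolution form of the difference operator on `Lᵖ × Lᵖ`: the dyadic pieces sum up because
`a + 1 < (2 / p - 1) (d + 1) / 2`. -/
theorem exists_norm_convForm_diffKernel_le (d : ℕ) [NeZero d] {r₀ a p : ℝ} (hr₀ : 0 < r₀)
    (hr₁ : r₀ ≤ 1) (ha₀ : 0 ≤ a) (ha₁ : a ≤ 1) (hp1 : 1 ≤ p) (hp2 : p ≤ 2)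
    (hap : a + 1 < (2 / p - 1) * (((d : ℝ) + 1) / 2)) :
    ∃ C, 0 ≤ C ∧ ∀ r, r₀ ≤ r → r ≤ 2 → ∀ t, t ≤ 1 → |r - 1| ≤ t →
      ∀ f g : EuclideanSpace ℝ (Fin d) → ℂ, Measurable f → Measurable g → Integrable f →
        Integrable g → Integrable (fun x => ‖f x‖ ^ p) → Integrable (fun x => ‖g x‖ ^ p) →
        ‖convForm (fun x => diffKernel d r ‖x‖) f g‖ ≤
          C * t ^ a * ((∫ x, ‖f x‖ ^ p) ^ (1 / p) * (∫ x, ‖g x‖ ^ p) ^ (1 / p)) := by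
  obtain ⟨C₁, hC₁0, hC₁⟩ := exists_norm_convForm_piece_le (ballCutoffSchwartz d)
    norm_ballCutoffSchwartz_le hr₀ hr₁ ha₀ ha₁ hp1 hp2
  obtain ⟨C₂, hC₂0, hC₂⟩ := exists_norm_convForm_piece_le (annulusCutoffSchwartz d)
    norm_annulusCutoffSchwartz_le hr₀ hr₁ ha₀ ha₁ hp1 hp2
  set e : ℝ := a + 1 - (2 / p - 1) * (((d : ℝ) + 1) / 2) with he
  have he0 : e < 0 := by rw [he]; linarith
  set q : ℝ := 2 ^ e with hq
  have hq0 : 0 < q := by positivity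
  have hq1 : q < 1 := Real.rpow_lt_one_of_one_lt_of_neg one_lt_two he0
  refine ⟨C₁ + C₂ * (1 - q)⁻¹, by have := sub_pos.2 hq1; positivity, ?_⟩
  intro r hr hr2 t ht1 hrt f g hfm hgm hf hg hfp hgp
  have ht : 0 ≤ t := (abs_nonneg _).trans hrt
  set N := (∫ x, ‖f x‖ ^ p) ^ (1 / p) * (∫ x, ‖g x‖ ^ p) ^ (1 / p) with hN
  have hN0 : 0 ≤ N := by
    have h1 : 0 ≤ ∫ x, ‖f x‖ ^ p := integral_nonneg fun x => by positivity
    have h2 : 0 ≤ ∫ x, ‖g x‖ ^ p := integral_nonneg fun x => by positivity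
    positivity
  obtain ⟨S, hS⟩ := exists_abs_diffKernel_le_const (d := d) (hr₀.le.trans hr)
  have hS0 : 0 ≤ S := (abs_nonneg _).trans (hS 0)
  have hKc := continuous_diffKernel (d := d) r
  have hbd : ∀ η : 𝓢(EuclideanSpace ℝ (Fin d), ℂ), (∀ x, ‖η x‖ ≤ 1) → ∀ lam : ℝ,
      Measurable (fun x => (diffKernel d r ‖x‖ : ℂ) * η (lam • x)) ∧
      ∀ x, ‖(diffKernel d r ‖x‖ : ℂ) * η (lam • x)‖ ≤ S := by
    intro η hη lam
    refine ⟨Continuous.measurable ?_, fun x => ?_⟩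
    · have := η.continuous
      fun_prop
    · rw [norm_mul, Complex.norm_real, Real.norm_eq_abs]
      calc |diffKernel d r ‖x‖| * ‖η (lam • x)‖ ≤ S * 1 := by
            gcongr
            · exact hS _
            · exact hη _
        _ = S := mul_one S
  -- `χ (2 ^ (-J) x) = χ x + ∑ (χ (2 ^ (-j) x) - χ (2 ^ (1 - j) x))`, one scale at a time
  have hpart : ∀ J : ℕ, ‖convForm (fun x => diffKernel d r ‖x‖ *
      ballCutoffSchwartz d (((2 : ℝ) ^ J)⁻¹ • x)) f g‖ ≤
        C₁ * t ^ a * N + C₂ * t ^ a * N * ∑ j ∈ Finset.range J, q ^ (j + 1) := by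
    intro J
    induction J with
    | zero =>
      have h := hC₁ r hr hr2 t ht1 hrt 1 le_rfl (fun x hx => ?_) f g hfm hgm hf hg hfp hgp
      · simp only [inv_one, one_smul, Real.one_rpow, mul_one] at h
        simp only [pow_zero, inv_one, one_smul, Finset.range_zero, Finset.sum_empty, mul_zero,
          add_zero]
        exact h
      · have : ‖x‖ < 2 := by
          by_contra! hx2
          refine hx ?_
          rw [ballCutoffSchwartz_apply, ballCutoff_eq_zero (by simpa using hx2)]
          simp
        constructor <;> linarith [norm_nonneg x]
    | succ J ih =>
      have hpow : (0 : ℝ) < 2 ^ (J + 1) := by positivity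
      have hone : (1 : ℝ) ≤ 2 ^ (J + 1) := one_le_pow₀ one_le_two
      have hsplit : (fun x : EuclideanSpace ℝ (Fin d) => (diffKernel d r ‖x‖ : ℂ) *
          ballCutoffSchwartz d (((2 : ℝ) ^ (J + 1))⁻¹ • x)) = fun x =>
          (diffKernel d r ‖x‖ : ℂ) * ballCutoffSchwartz d (((2 : ℝ) ^ J)⁻¹ • x) +
          (diffKernel d r ‖x‖ : ℂ) * annulusCutoffSchwartz d (((2 : ℝ) ^ (J + 1))⁻¹ • x) := by
        funext x
        rw [annulusCutoffSchwartz_apply, ballCutoffSchwartz_apply, ballCutoffSchwartz_apply,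
          smul_smul]
        have : (2 : ℝ) * (2 ^ (J + 1))⁻¹ = (2 ^ J)⁻¹ := by
          rw [pow_succ]
          field_simp
        rw [this]
        push_cast
        ring
      obtain ⟨m1, b1⟩ := hbd (ballCutoffSchwartz d) norm_ballCutoffSchwartz_le ((2 : ℝ) ^ J)⁻¹
      obtain ⟨m2, b2⟩ := hbd (annulusCutoffSchwartz d) norm_annulusCutoffSchwartz_le
        ((2 : ℝ) ^ (J + 1))⁻¹
      rw [hsplit, convForm_add m1 m2 b1 b2 hf hg, Finset.sum_range_succ]
      have h := hC₂ r hr hr2 t ht1 hrt (2 ^ (J + 1)) hone (fun x hx => ?_) f g hfm hgm hf hg hfp hgp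
      · have hqe : ((2 : ℝ) ^ (J + 1)) ^ e = q ^ (J + 1) := by
          rw [hq, ← Real.rpow_natCast, ← Real.rpow_natCast, ← Real.rpow_mul (by norm_num),
            ← Real.rpow_mul (by norm_num), mul_comm]
        rw [hqe] at h
        refine (norm_add_le _ _).trans ((add_le_add ih h).trans (le_of_eq ?_))
        ring
      · obtain ⟨h1, h2⟩ := norm_of_annulusCutoffSchwartz_ne_zero hx
        rw [norm_smul, norm_inv, Real.norm_of_nonneg hpow.le, inv_mul_eq_div] at h1 h2
        rw [le_div_iff₀ hpow] at h1
        rw [div_le_iff₀ hpow] at h2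
        constructor <;> linarith
  have hlim : Filter.Tendsto (fun J : ℕ => convForm (fun x => diffKernel d r ‖x‖ *
      ballCutoffSchwartz d (((2 : ℝ) ^ J)⁻¹ • x)) f g) Filter.atTop
      (nhds (convForm (fun x => diffKernel d r ‖x‖) f g)) := by
    refine tendsto_integral_of_dominated_convergence
      (fun z : EuclideanSpace ℝ (Fin d) × EuclideanSpace ℝ (Fin d) => S * (‖g z.1‖ * ‖f z.2‖))
      (fun J => ?_) ((hg.norm.mul_prod hf.norm).const_mul S)
      (fun J => Filter.Eventually.of_forall fun z => ?_)
      (Filter.Eventually.of_forall fun z => ?_)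
    · obtain ⟨m1, b1⟩ := hbd (ballCutoffSchwartz d) norm_ballCutoffSchwartz_le ((2 : ℝ) ^ J)⁻¹
      exact (integrable_convForm m1 b1 hf hg).1
    · rw [norm_mul, norm_mul (g z.1)]
      gcongr
      exact (hbd _ norm_ballCutoffSchwartz_le _).2 _
    · refine tendsto_const_nhds.congr' ?_
      obtain ⟨n, hn⟩ := pow_unbounded_of_one_lt ‖z.1 - z.2‖ (one_lt_two (α := ℝ))
      filter_upwards [Filter.eventually_ge_atTop n] with J hJ
      have hJ' : (2 : ℝ) ^ n ≤ 2 ^ J := pow_le_pow_right₀ one_le_two hJ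
      rw [ballCutoffSchwartz_apply, ballCutoff_eq_one]
      · simp
      · rw [norm_smul, norm_inv, Real.norm_of_nonneg (by positivity), inv_mul_eq_div]
        exact div_le_one_of_le₀ (hn.le.trans hJ') (by positivity)
  refine le_of_tendsto hlim.norm (Filter.Eventually.of_forall fun J => ?_)
  refine (hpart J).trans ?_
  have hsum : ∑ j ∈ Finset.range J, q ^ (j + 1) ≤ (1 - q)⁻¹ := by
    have h1 : ∑ j ∈ Finset.range J, q ^ (j + 1) ≤ ∑ j ∈ Finset.range J, q ^ j :=
      Finset.sum_le_sum fun j _ => pow_le_pow_of_le_one hq0.le hq1.le (Nat.le_succ j)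
    refine h1.trans ?_
    rw [← tsum_geometric_of_lt_one hq0.le hq1]
    exact (summable_geometric_of_lt_one hq0.le hq1).sum_le_tsum _ fun j _ => by positivity
  calc _ ≤ C₁ * t ^ a * N + C₂ * t ^ a * N * (1 - q)⁻¹ := by gcongr
    _ = _ := by ring

end Dyadic

/-! ### From the convolution form to an operator on `Lᵖ` -/

section Operator

variable {d : ℕ}

/-- Converse of Hölder's inequality: the test function is `conj h * ‖h‖ ^ (p' - 2)`, truncated
to balls so that its norms are finite. -/
theorem eLpNorm_le_of_forall_integral_mul_le {h : EuclideanSpace ℝ (Fin d) → ℂ} {p p' D S : ℝ}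
    (hpp' : p.HolderConjugate p') (hhm : Measurable h) (hS : ∀ x, ‖h x‖ ≤ S) (hD0 : 0 ≤ D)
    (hD : ∀ g : EuclideanSpace ℝ (Fin d) → ℂ, Measurable g → Integrable g →
      Integrable (fun x => ‖g x‖ ^ p) → ‖∫ x, h x * g x‖ ≤ D * (∫ x, ‖g x‖ ^ p) ^ (1 / p)) :
    eLpNorm h (ENNReal.ofReal p') volume ≤ ENNReal.ofReal D := by
  have hp'0 : 0 < p' := hpp'.symm.pos
  have hp'1 : 1 < p' := hpp'.symm.lt
  have hp0 : 0 < p := hpp'.pos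
  have hball : ∀ R : ℝ, ∫⁻ x in Metric.ball (0 : EuclideanSpace ℝ (Fin d)) R, ‖h x‖ₑ ^ p'
      ≤ ENNReal.ofReal (D ^ p') := by
    intro R
    set A := Metric.ball (0 : EuclideanSpace ℝ (Fin d)) R with hA
    have hAm : MeasurableSet A := measurableSet_ball
    have hAfin : volume A ≠ ∞ := measure_ball_lt_top.ne
    set u : EuclideanSpace ℝ (Fin d) → ℂ :=
      fun x => starRingEnd ℂ (h x) * ((‖h x‖ ^ (p' - 2) : ℝ) : ℂ) with hu
    have hum : Measurable u := by
      have hc : Measurable fun z : ℂ => starRingEnd ℂ z := Complex.continuous_conj.measurable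
      exact (hc.comp hhm).mul
        (Complex.measurable_ofReal.comp (hhm.norm.pow_const _))
    have hun : ∀ x, ‖u x‖ = ‖h x‖ ^ (p' - 1) := by
      intro x
      rw [hu]
      simp only
      rw [norm_mul, RCLike.norm_conj, Complex.norm_real, Real.norm_of_nonneg (by positivity)]
      by_cases hx : ‖h x‖ = 0
      · rw [hx, zero_mul, Real.zero_rpow (by linarith)]
      · rw [mul_comm, ← Real.rpow_add_one hx]
        ring_nf
    have hhu : ∀ x, h x * u x = ((‖h x‖ ^ p' : ℝ) : ℂ) := by
      intro x
      rw [hu]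
      simp only
      rw [← mul_assoc, Complex.mul_conj, Complex.normSq_eq_norm_sq]
      by_cases hx : ‖h x‖ = 0
      · rw [hx, Real.zero_rpow hp'0.ne']
        simp
      · rw [← Complex.ofReal_mul, ← Real.rpow_two, ← Real.rpow_add (by positivity)]
        ring_nf
    have hunp : ∀ x, ‖u x‖ ^ p = ‖h x‖ ^ p' := by
      intro x
      rw [hun, ← Real.rpow_mul (norm_nonneg _), hpp'.symm.sub_one_mul_conj]
    have hi : IntegrableOn (fun x => ‖h x‖ ^ p') A := by
      refine Measure.integrableOn_of_bounded (M := S ^ p') hAfin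
        (hhm.norm.pow_const _).aestronglyMeasurable (Filter.Eventually.of_forall fun x => ?_)
      rw [Real.norm_of_nonneg (by positivity)]
      exact Real.rpow_le_rpow (norm_nonneg _) (hS x) hp'0.le
    have hgi : IntegrableOn u A := by
      refine Measure.integrableOn_of_bounded (M := S ^ (p' - 1)) hAfin
        hum.aestronglyMeasurable (Filter.Eventually.of_forall fun x => ?_)
      rw [hun]
      exact Real.rpow_le_rpow (norm_nonneg _) (hS x) (by linarith)
    have hpow : (fun x => ‖A.indicator u x‖ ^ p) = A.indicator fun x => ‖h x‖ ^ p' := by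
      funext x
      by_cases hx : x ∈ A
      · simp [hx, hunp]
      · simp [hx, Real.zero_rpow hp0.ne']
    have hmul : (fun x => h x * A.indicator u x)
        = A.indicator fun x => ((‖h x‖ ^ p' : ℝ) : ℂ) := by
      funext x
      by_cases hx : x ∈ A
      · simp only [hx, indicator_of_mem, hhu]
      · simp [hx]
    have key := hD (A.indicator u) (hum.indicator hAm) (hgi.integrable_indicator hAm)
      (by rw [hpow]; exact hi.integrable_indicator hAm)
    rw [hpow, hmul, integral_indicator hAm, integral_indicator hAm, integral_complex_ofReal,
      Complex.norm_real] at key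
    set I := ∫ x in A, ‖h x‖ ^ p' with hI
    have hI0 : 0 ≤ I := integral_nonneg fun x => by positivity
    rw [Real.norm_of_nonneg hI0] at key
    have hID : I ≤ D ^ p' := by
      rcases hI0.eq_or_lt with h0 | h0
      · rw [← h0]; positivity
      · have h1 : I ^ (1 / p') ≤ D := by
          have e : I = I ^ (1 / p') * I ^ (1 / p) := by
            rw [← Real.rpow_add h0]
            have := hpp'.symm.inv_add_inv_eq_one
            rw [one_div, one_div, this, Real.rpow_one]
          have h2 : 0 < I ^ (1 / p) := by positivity
          nth_rewrite 1 [e] at key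
          exact le_of_mul_le_mul_right key h2
        calc I = (I ^ (1 / p')) ^ p' := by
              rw [← Real.rpow_mul hI0, one_div_mul_cancel hp'0.ne', Real.rpow_one]
          _ ≤ D ^ p' := Real.rpow_le_rpow (by positivity) h1 hp'0.le
    have hconv : ∫⁻ x in A, ‖h x‖ₑ ^ p' = ENNReal.ofReal I := by
      rw [hI, ofReal_integral_eq_lintegral_ofReal hi
        (Filter.Eventually.of_forall fun x => by positivity)]
      refine lintegral_congr fun x => ?_
      rw [← ENNReal.ofReal_rpow_of_nonneg (norm_nonneg _) hp'0.le, ofReal_norm]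
    rw [hconv]
    exact ENNReal.ofReal_le_ofReal hID
  have hlim := (aecover_ball (μ := (volume : Measure (EuclideanSpace ℝ (Fin d)))) (x := 0)
    (r := fun n : ℕ => (n : ℝ)) tendsto_natCast_atTop_atTop).lintegral_tendsto_of_countably_generated
      (f := fun x => ‖h x‖ₑ ^ p') (hhm.enorm.pow_const _).aemeasurable
  have hle := le_of_tendsto hlim (Filter.Eventually.of_forall fun n => hball n)
  rw [eLpNorm_eq_lintegral_rpow_enorm_toReal (by simpa using hp'0) ENNReal.ofReal_ne_top,
    ENNReal.toReal_ofReal hp'0.le]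
  calc (∫⁻ x, ‖h x‖ₑ ^ p') ^ (1 / p') ≤ (ENNReal.ofReal (D ^ p')) ^ (1 / p') := by gcongr
    _ = ENNReal.ofReal D := by
        rw [ENNReal.ofReal_rpow_of_nonneg (by positivity) (by positivity), ← Real.rpow_mul hD0,
          mul_one_div_cancel hp'0.ne', Real.rpow_one]

/-- `𝓕_{ρS}^* 𝓕_{ρS}` is the convolution with the Fourier transform of the surface measure. -/
theorem fourierExtRestr_eq_integral [NeZero d] {ρ : ℝ} (hρ : 0 ≤ ρ)
    (φ : 𝓢(EuclideanSpace ℝ (Fin d), ℂ)) (x : EuclideanSpace ℝ (Fin d)) :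
    fourierExtRestr d ρ φ x =
      ∫ y, ((ρ ^ (d - 1) * sphereProfile d (ρ * ‖x - y‖) : ℝ) : ℂ) * φ y := by
  have h1 : fourierExtRestr d ρ φ x = ∫ ξ, Complex.exp (2 * Real.pi * Complex.I * (inner ℝ x ξ : ℝ))
      * (𝓕 φ : 𝓢(EuclideanSpace ℝ (Fin d), ℂ)) ξ ∂sphereMeasure d ρ := by
    unfold fourierExtRestr fourierExtension
    refine integral_congr_ae ?_
    have h : fourierRestriction d ρ φ =ᵐ[sphereMeasure d ρ]
        (𝓕 φ : 𝓢(EuclideanSpace ℝ (Fin d), ℂ)) := SchwartzMap.coeFn_toLp _ 2 _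
    filter_upwards [h] with ξ hξ
    rw [hξ]
  have hc := (𝓕 φ : 𝓢(EuclideanSpace ℝ (Fin d), ℂ)).continuous
  rw [h1, integral_sphereMeasure hρ (by fun_prop)]
  have h2 : ∀ ω : EuclideanSpace ℝ (Fin d),
      Complex.exp (2 * Real.pi * Complex.I * (inner ℝ x (ρ • ω) : ℝ)) *
        (𝓕 φ : 𝓢(EuclideanSpace ℝ (Fin d), ℂ)) (ρ • ω)
      = ∫ y, Complex.exp (2 * Real.pi * Complex.I * (inner ℝ (ρ • (x - y)) ω : ℝ)) * φ y := by
    intro ω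
    rw [SchwartzMap.fourier_coe, Real.fourier_eq', ← integral_const_mul]
    refine integral_congr_ae (Filter.Eventually.of_forall fun y => ?_)
    simp only [smul_eq_mul]
    rw [← mul_assoc, ← Complex.exp_add]
    congr 2
    simp only [inner_smul_left, inner_smul_right, inner_sub_left, RCLike.conj_to_real]
    push_cast
    ring
  simp only [h2]
  have hφc := φ.continuous
  rw [integral_integral_swap]
  · simp only [integral_mul_const, integral_exp_inner_eq_sphereProfile, norm_smul,
      Real.norm_of_nonneg hρ]
    rw [← integral_smul]
    refine integral_congr_ae (Filter.Eventually.of_forall fun y => ?_)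
    simp only [Complex.real_smul]
    push_cast
    ring
  · have hi := (integrable_const (μ := unitSphereMeasure d) (1 : ℂ)).mul_prod (φ.integrable (μ := volume))
    refine hi.mono (Continuous.aestronglyMeasurable ?_) (Filter.Eventually.of_forall fun p => ?_)
    · unfold Function.uncurry
      fun_prop
    · simp only [Function.uncurry, norm_mul, norm_exp_two_pi_I_mul, norm_one, le_refl]

/-- The operator `𝓕_{rS}^* 𝓕_{rS} - r 𝓕_S^* 𝓕_S` on Schwartz functions. -/
noncomputable def diffOperator (d : ℕ) (r : ℝ) (φ : 𝓢(EuclideanSpace ℝ (Fin d), ℂ))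
    (x : EuclideanSpace ℝ (Fin d)) : ℂ :=
  fourierExtRestr d r φ x - (r : ℂ) * fourierExtRestr d 1 φ x

theorem integrable_bdd_mul_schwartz {k : EuclideanSpace ℝ (Fin d) → ℂ} {S : ℝ}
    (hk : Continuous k) (hS : ∀ x, ‖k x‖ ≤ S) (φ : 𝓢(EuclideanSpace ℝ (Fin d), ℂ)) :
    Integrable fun y => k y * φ y :=
  φ.integrable.bdd_mul (c := S) hk.aestronglyMeasurable (Filter.Eventually.of_forall hS)

theorem diffOperator_eq_integral [NeZero d] {r : ℝ} (hr : 0 ≤ r)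
    (φ : 𝓢(EuclideanSpace ℝ (Fin d), ℂ)) (x : EuclideanSpace ℝ (Fin d)) :
    diffOperator d r φ x = ∫ y, (diffKernel d r ‖x - y‖ : ℂ) * φ y := by
  obtain ⟨S, hS⟩ := exists_abs_sphereProfile_le (d := d)
  have hg := continuous_sphereProfile (d := d)
  have hi : ∀ ρ : ℝ, 0 ≤ ρ → Integrable fun y : EuclideanSpace ℝ (Fin d) =>
      ((ρ ^ (d - 1) * sphereProfile d (ρ * ‖x - y‖) : ℝ) : ℂ) * φ y := by
    intro ρ hρ
    refine integrable_bdd_mul_schwartz (S := ρ ^ (d - 1) * S) (by fun_prop) (fun y => ?_) φ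
    rw [Complex.norm_real, Real.norm_eq_abs, abs_mul, abs_of_nonneg (by positivity)]
    gcongr
    exact hS _
  unfold diffOperator
  rw [fourierExtRestr_eq_integral hr, fourierExtRestr_eq_integral zero_le_one,
    ← integral_const_mul, ← integral_sub (hi r hr) ((hi 1 zero_le_one).const_mul _)]
  refine integral_congr_ae (Filter.Eventually.of_forall fun y => ?_)
  simp only [diffKernel, one_pow, one_mul]
  push_cast
  ring

theorem measurable_diffOperator [NeZero d] {r : ℝ} (hr : 0 ≤ r)
    (φ : 𝓢(EuclideanSpace ℝ (Fin d), ℂ)) : Measurable (diffOperator d r φ) := by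
  have hK := continuous_diffKernel (d := d) r
  have hφ := φ.continuous
  have hc : Continuous fun z : EuclideanSpace ℝ (Fin d) × EuclideanSpace ℝ (Fin d) =>
      (diffKernel d r ‖z.1 - z.2‖ : ℂ) * φ z.2 := by fun_prop
  rw [funext (diffOperator_eq_integral hr φ)]
  exact (hc.stronglyMeasurable.integral_prod_right' (ν := volume)).measurable

theorem norm_diffOperator_le [NeZero d] {r S : ℝ} (hr : 0 ≤ r)
    (hS : ∀ R, 0 ≤ R → |diffKernel d r R| ≤ S) (φ : 𝓢(EuclideanSpace ℝ (Fin d), ℂ))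
    (x : EuclideanSpace ℝ (Fin d)) : ‖diffOperator d r φ x‖ ≤ S * ∫ y, ‖φ y‖ := by
  rw [diffOperator_eq_integral hr, ← integral_const_mul]
  refine norm_integral_le_of_norm_le (φ.integrable.norm.const_mul S)
    (Filter.Eventually.of_forall fun y => ?_)
  rw [norm_mul, Complex.norm_real, Real.norm_eq_abs]
  gcongr
  exact hS _ (norm_nonneg _)

theorem integral_diffOperator_mul [NeZero d] {r S : ℝ} (hr : 0 ≤ r)
    (hS : ∀ R, 0 ≤ R → |diffKernel d r R| ≤ S) (φ : 𝓢(EuclideanSpace ℝ (Fin d), ℂ))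
    {g : EuclideanSpace ℝ (Fin d) → ℂ} (hg : Integrable g) :
    ∫ x, diffOperator d r φ x * g x = convForm (fun x => diffKernel d r ‖x‖) φ g := by
  have hK := continuous_diffKernel (d := d) r
  have hi := integrable_convForm (k := fun x : EuclideanSpace ℝ (Fin d) => (diffKernel d r ‖x‖ : ℂ))
    (S := S) (Continuous.measurable (by fun_prop)) (fun x => by
      rw [Complex.norm_real, Real.norm_eq_abs]; exact hS _ (norm_nonneg _)) φ.integrable hg
  unfold convForm
  rw [Measure.volume_eq_prod] at hi ⊢
  rw [integral_prod _ hi]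
  refine integral_congr_ae (Filter.Eventually.of_forall fun x => ?_)
  simp only
  rw [diffOperator_eq_integral hr, ← integral_mul_const]
  refine integral_congr_ae (Filter.Eventually.of_forall fun y => ?_)
  simp only
  ring

/-- The `Lᵖ → L^{p'}` bound on Schwartz functions. For `p = 1` it is a bound on the kernel. -/
theorem exists_eLpNorm_diffOperator_le (d : ℕ) [NeZero d] {p p' : ℝ≥0∞} [Fact (1 ≤ p)]
    (hpp' : p.HolderConjugate p') {r₀ a : ℝ} (hr₀ : 0 < r₀)
    (hr₁ : r₀ ≤ 1) (ha₀ : 0 ≤ a) (ha₁ : a ≤ 1) (hp : p ≠ ∞) (hp2 : p.toReal ≤ 2)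
    (hap : a + 1 < (2 / p.toReal - 1) * (((d : ℝ) + 1) / 2)) :
    ∃ C, 0 ≤ C ∧ ∀ r, r₀ ≤ r → r ≤ 2 → ∀ t, t ≤ 1 → |r - 1| ≤ t →
      ∀ φ : 𝓢(EuclideanSpace ℝ (Fin d), ℂ),
        eLpNorm (diffOperator d r φ) p' volume ≤
          ENNReal.ofReal (C * t ^ a * ‖φ.toLp p volume‖) := by
  have hp1 : 1 ≤ p.toReal := by
    rw [← ENNReal.toReal_one]
    exact ENNReal.toReal_mono hp Fact.out
  have hp0 : p ≠ 0 := (zero_lt_one.trans_le (Fact.out : 1 ≤ p)).ne'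
  have hnorm : ∀ φ : 𝓢(EuclideanSpace ℝ (Fin d), ℂ),
      ‖φ.toLp p volume‖ = (∫ x, ‖φ x‖ ^ p.toReal) ^ (1 / p.toReal) := fun φ => by
    rw [SchwartzMap.norm_toLp' hp0 hp, one_div]
  rcases hp1.eq_or_lt with h1 | h1
  · have hp' : p' = ∞ := by
      have hp_one : p = 1 := by
        rw [← ENNReal.ofReal_toReal hp, ← h1, ENNReal.ofReal_one]
      have := ENNReal.holderConjugate_iff.1 hpp'
      rw [hp_one, inv_one] at this
      have h0 : p'⁻¹ = 0 := by
        have h2 : (1 : ℝ≥0∞) + p'⁻¹ = 1 + 0 := by rw [this, add_zero]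
        exact (ENNReal.add_right_inj ENNReal.one_ne_top).1 h2
      simpa using h0
    obtain ⟨C, hC0, hC⟩ := exists_diffKernel_le d hr₀ hr₁ ha₀ ha₁
    refine ⟨C, hC0, fun r hr hr2 t ht1 hrt φ => ?_⟩
    have ht : 0 ≤ t := (abs_nonneg _).trans hrt
    have hab : a ≤ ((d - 1 : ℕ) : ℝ) / 2 := by
      rw [Nat.cast_sub NeZero.one_le, Nat.cast_one]
      rw [← h1] at hap
      linarith
    have hK : ∀ R, 0 ≤ R → |diffKernel d r R| ≤ C * t ^ a := by
      intro R hR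
      refine (hC r hr hr2 t ht1 hrt R hR).trans ?_
      rw [Real.mul_rpow ht (by positivity), mul_assoc, mul_assoc, ← Real.rpow_add (by positivity)]
      refine mul_le_mul_of_nonneg_left (mul_le_of_le_one_right (by positivity) ?_) hC0
      exact Real.rpow_le_one_of_one_le_of_nonpos (by linarith) (by linarith)
    rw [hp', eLpNorm_exponent_top]
    refine eLpNormEssSup_le_of_ae_bound (Filter.Eventually.of_forall fun x => ?_)
    refine (norm_diffOperator_le (hr₀.le.trans hr) hK φ x).trans (le_of_eq ?_)
    rw [hnorm, ← h1]
    simp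
  · have hconj : p.toReal.HolderConjugate p'.toReal := ENNReal.HolderConjugate.toReal h1
    have hp' : p' ≠ ∞ := by
      intro h
      have := hconj.symm.pos
      simp [h] at this
    obtain ⟨C, hC0, hC⟩ := exists_norm_convForm_diffKernel_le d hr₀ hr₁ ha₀ ha₁ hp1 hp2 hap
    refine ⟨C, hC0, fun r hr hr2 t ht1 hrt φ => ?_⟩
    have ht : 0 ≤ t := (abs_nonneg _).trans hrt
    have hr0 : 0 ≤ r := hr₀.le.trans hr
    obtain ⟨S, hS⟩ := exists_abs_diffKernel_le_const (d := d) hr0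
    rw [← ENNReal.ofReal_toReal hp']
    refine eLpNorm_le_of_forall_integral_mul_le hconj (measurable_diffOperator hr0 φ)
      (norm_diffOperator_le hr0 (fun R _ => hS R) φ) (by positivity) fun g hgm hg hgp => ?_
    rw [integral_diffOperator_mul hr0 (fun R _ => hS R) φ hg, hnorm, mul_assoc]
    exact hC r hr hr2 t ht1 hrt φ g φ.continuous.measurable hgm φ.integrable hg
      ((φ.memLp p volume).integrable_norm_rpow hp0 hp) hgp

/-- Extension by density of the Schwartz functions in `Lᵖ`, `p < ∞`. -/
theorem exists_extendsOnSchwartz {p p' : ℝ≥0∞} [Fact (1 ≤ p)] [Fact (1 ≤ p')] (hp : p ≠ ∞)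
    {T : 𝓢(EuclideanSpace ℝ (Fin d), ℂ) → EuclideanSpace ℝ (Fin d) → ℂ} {D : ℝ} (hD : 0 ≤ D)
    (hadd : ∀ φ ψ x, T (φ + ψ) x = T φ x + T ψ x) (hsmul : ∀ (c : ℂ) φ x, T (c • φ) x = c * T φ x)
    (hm : ∀ φ, Measurable (T φ))
    (hT : ∀ φ, eLpNorm (T φ) p' volume ≤ ENNReal.ofReal (D * ‖φ.toLp p volume‖)) :
    ∃ A : Lp ℂ p (volume : Measure (EuclideanSpace ℝ (Fin d))) →L[ℂ]
      Lp ℂ p' (volume : Measure (EuclideanSpace ℝ (Fin d))),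
      ExtendsOnSchwartz T A ∧ ‖A‖ ≤ D := by
  have hmem : ∀ φ, MemLp (T φ) p' volume := fun φ =>
    ⟨(hm φ).aestronglyMeasurable, (hT φ).trans_lt ENNReal.ofReal_lt_top⟩
  set F : 𝓢(EuclideanSpace ℝ (Fin d), ℂ) →ₗ[ℂ]
      Lp ℂ p' (volume : Measure (EuclideanSpace ℝ (Fin d))) :=
    { toFun := fun φ => (hmem φ).toLp (T φ)
      map_add' := fun φ ψ => by
        rw [← MemLp.toLp_add]
        exact MemLp.toLp_congr _ _ (Filter.Eventually.of_forall (hadd φ ψ))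
      map_smul' := fun c φ => by
        rw [RingHom.id_apply, ← MemLp.toLp_const_smul]
        exact MemLp.toLp_congr _ _ (Filter.Eventually.of_forall (hsmul c φ)) } with hF
  set e : 𝓢(EuclideanSpace ℝ (Fin d), ℂ) →ₗ[ℂ]
      Lp ℂ p (volume : Measure (EuclideanSpace ℝ (Fin d))) :=
    (SchwartzMap.toLpCLM ℂ ℂ p volume).toLinearMap with he
  have hdense : DenseRange e := SchwartzMap.denseRange_toLpCLM hp
  have hbound : ∀ φ, ‖F φ‖ ≤ D * ‖e φ‖ := by
    intro φ
    change ‖(hmem φ).toLp (T φ)‖ ≤ D * ‖φ.toLp p volume‖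
    rw [Lp.norm_toLp]
    exact ENNReal.toReal_le_of_le_ofReal (by positivity) (hT φ)
  refine ⟨F.extendOfNorm e, fun φ => ?_, LinearMap.opNorm_extendOfNorm_le hdense hD hbound⟩
  have h : F.extendOfNorm e (φ.toLp p volume) = (hmem φ).toLp (T φ) :=
    LinearMap.extendOfNorm_eq hdense ⟨D, hbound⟩ φ
  rw [h]
  exact (hmem φ).coeFn_toLp

end Operator

theorem mainTheorem9 (d : ℕ) (hd : 2 ≤ d) (τ : ℝ) (hτ₀ : 0 < τ) (hτ₁ : τ < 1)
    (p p' : ℝ≥0∞) [Fact (1 ≤ p)] [Fact (1 ≤ p')] (hpp' : p.HolderConjugate p')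
    (hp : p < ENNReal.ofReal (2 * ((d : ℝ) + 1) / ((d : ℝ) + 3)))
    (q : ℝ) (hq : 1 / q = (1 / p).toReal - (1 / p').toReal)
    (α : ℝ) (hα₀ : 0 < α) (hα₁ : α < min (((d : ℝ) + 1) / 2 - q) q) :
    ∃ C : ℝ, ∀ t ∈ Ioo (0 : ℝ) τ, ∀ s ∈ ({1, -1} : Set ℝ),
      ∃ A : Lp ℂ p (volume : Measure (EuclideanSpace ℝ (Fin d))) →L[ℂ]
          Lp ℂ p' (volume : Measure (EuclideanSpace ℝ (Fin d))),
        ExtendsOnSchwartz (fun φ x => fourierExtRestr d (Real.sqrt (1 + s * t)) φ x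
            - (Real.sqrt (1 + s * t) : ℂ) * fourierExtRestr d 1 φ x) A ∧
          ‖A‖ ≤ C * t ^ (α / q) := by
  have : NeZero d := ⟨by omega⟩
  have hd0 : (0 : ℝ) ≤ d := Nat.cast_nonneg d
  have hp_top : p ≠ ∞ := (hp.trans ENNReal.ofReal_lt_top).ne
  have hP1 : 1 ≤ p.toReal := by
    rw [← ENNReal.toReal_one]
    exact ENNReal.toReal_mono hp_top Fact.out
  have hP0 : 0 < p.toReal := by linarith
  have hPlt : p.toReal < 2 * ((d : ℝ) + 1) / ((d : ℝ) + 3) :=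
    (ENNReal.lt_ofReal_iff_toReal_lt hp_top).1 hp
  have hP2 : p.toReal ≤ 2 := by
    refine hPlt.le.trans ?_
    rw [div_le_iff₀ (by positivity)]
    linarith
  have hqθ : 1 / q = 2 / p.toReal - 1 := by
    have h := congrArg ENNReal.toReal (ENNReal.holderConjugate_iff.1 hpp')
    have hp0 : p⁻¹ ≠ ∞ :=
      ENNReal.inv_ne_top.2 (zero_lt_one.trans_le (Fact.out : 1 ≤ p)).ne'
    have hp'0 : p'⁻¹ ≠ ∞ :=
      ENNReal.inv_ne_top.2 (zero_lt_one.trans_le (Fact.out : 1 ≤ p')).ne'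
    rw [ENNReal.toReal_add hp0 hp'0, ENNReal.toReal_inv, ENNReal.toReal_one] at h
    rw [hq, one_div, one_div, ENNReal.toReal_inv]
    rw [div_eq_mul_inv]
    linarith
  have hα₂ : α < q := hα₁.trans_le (min_le_right _ _)
  have hα₃ : α < ((d : ℝ) + 1) / 2 - q := hα₁.trans_le (min_le_left _ _)
  have hq0 : 0 < q := hα₀.trans hα₂
  have ha₀ : 0 ≤ α / q := by positivity
  have ha₁ : α / q ≤ 1 := (div_le_one hq0).2 hα₂.le
  have hap : α / q + 1 < (2 / p.toReal - 1) * (((d : ℝ) + 1) / 2) := by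
    rw [← hqθ, one_div_mul_eq_div, lt_div_iff₀ hq0, add_mul, div_mul_cancel₀ _ hq0.ne']
    linarith
  have hr₀ : 0 < Real.sqrt (1 - τ) := Real.sqrt_pos.2 (by linarith)
  have hr₁ : Real.sqrt (1 - τ) ≤ 1 := Real.sqrt_le_one.2 (by linarith)
  obtain ⟨C, hC0, hC⟩ := exists_eLpNorm_diffOperator_le d hpp' hr₀ hr₁ ha₀ ha₁ hp_top hP2 hap
  refine ⟨C, fun t ht s hs => ?_⟩
  have hst : |s * t| = t := by
    rcases hs with rfl | rfl <;> simp [abs_of_pos ht.1]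
  have hst' := abs_le.1 hst.le
  set r := Real.sqrt (1 + s * t) with hr
  have hr0 : 0 ≤ r := Real.sqrt_nonneg _
  have hrr : r * r = 1 + s * t := Real.mul_self_sqrt (by linarith [ht.2])
  have hrτ : Real.sqrt (1 - τ) ≤ r := Real.sqrt_le_sqrt (by linarith [ht.2])
  have hr2 : r ≤ 2 := by nlinarith [ht.2]
  have hrt : |r - 1| ≤ t := by
    have h1 : |r - 1| * (r + 1) = t := by
      have h2 : (r - 1) * (r + 1) = s * t := by linarith
      rw [← hst, ← h2, abs_mul, abs_of_nonneg (by linarith : 0 ≤ r + 1)]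
    nlinarith [abs_nonneg (r - 1)]
  have hbound := hC r hrτ hr2 t (by linarith [ht.2]) hrt
  have ht0 := ht.1.le
  refine exists_extendsOnSchwartz (T := diffOperator d r) hp_top (by positivity) ?_ ?_
    (measurable_diffOperator hr0) hbound
  · intro φ ψ x
    obtain ⟨S, hS⟩ := exists_abs_diffKernel_le_const (d := d) hr0
    have hK := continuous_diffKernel (d := d) r
    have hi := integrable_bdd_mul_schwartz (k := fun y => (diffKernel d r ‖x - y‖ : ℂ)) (S := S)
      (by fun_prop) (fun y => by
        rw [Complex.norm_real, Real.norm_eq_abs]; exact hS _)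
    rw [diffOperator_eq_integral hr0, diffOperator_eq_integral hr0, diffOperator_eq_integral hr0,
      ← integral_add (hi φ) (hi ψ)]
    simp only [add_apply, mul_add]
  · intro c φ x
    rw [diffOperator_eq_integral hr0, diffOperator_eq_integral hr0, ← integral_const_mul]
    simp only [smul_apply, smul_eq_mul]
    refine integral_congr_ae (Filter.Eventually.of_forall fun y => ?_)
    simp only
    ring
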